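/- A \emph{local measure} on $\mathbb R$ is a function $\mu:\{B\subseteq\mathbb R : B \text{ bounded Borel}\}\to\mathbb R$ such that $\mathbf 1_K\mu:=\mu(\cdot\cap K)$ is a signed Radon measure for every compact $K\subseteq\mathbb R$; $|\mu|$ denotes its total variation. Let $\mathcal M$ be the space of local measures with $\|\mu\|_{\mathrm{lu}}:=\sup_{a\in\mathbb R}|\mu|((a,a+1])<\infty$. For $\mu\in\mathcal M$ let $H_\mu$ be the maximal operator associated with $-\Delta+\mu$ in the complex space $L_2(\mathbb R)$, $$D(H_\mu)=\{u\in L_2(\mathbb R)\cap C(\mathbb R) : -u''+u\mu\in L_2(\mathbb R)\},\qquad H_\mu u=-u''+u\mu,$$ where $-u''+u\mu$ is understood in the sense of distributions. Let $\Omega\subseteq\mathcal M$ be $\|\cdot\|_{\mathrm{lu}}$-bounded, closed in $\mathcal M$ with respect to the vague topology (the topology generated by $\mu\mapsto\int\varphi\,d\mu$, $\varphi\in C_c(\mathbb R)$), and invariant under the translations $\alpha_t(\omega):=\omega(\cdot+t)$, $t\in\mathbb R$. Let $\mathbb P$ be an ergodic measure for $(\Omega,\alpha)$, that is, a Borel probability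 measure on $\Omega$ that is invariant under all $\alpha_t$ and such that every Borel set $A\subseteq\Omega$ with $\alpha_t^{-1}(A)=A$ for all $t\in\mathbb R$ satisfies $\mathbb P(A)\in\{0,1\}$. Assume condition (K): there is a sequence $(p_n)$ in $(0,\infty)$ with $p_n\to\infty$ such that the sets $$G_n:=\{\omega\in\Omega : \mathbf 1_{[0,p_n]}\omega=\mathbf 1_{[0,p_n]}\alpha_{p_n}(\omega)=\mathbf 1_{[0,p_n]}\alpha_{-p_n}(\omega)\}$$ satisfy $\limsup_{n\to\infty}\mathbb P(G_n)>0$. Then for $\mathbb P$-almost every $\omega\in\Omega$ the operator $H_\omega$ has no eigenvalues, i.e. $\sigma_{pp}(H_\omega)=\emptyset$. -/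

import Mathlib

open MeasureTheory Set Filter Topology
open scoped ENNReal CompactlySupported

/-- The bounded Borel subsets of `ℝ`. -/
abbrev BoundedBorel : Type := {B : Set ℝ // Bornology.IsBounded B ∧ MeasurableSet B}

/-- The intersection of a Borel set with a compact set. -/
def BoundedBorel.interCompact (A K : Set ℝ) (hA : MeasurableSet A) (hK : IsCompact K) :
    BoundedBorel :=
  ⟨A ∩ K, hK.isBounded.subset inter_subset_right, hA.inter hK.measurableSet⟩

/-- A local measure on `ℝ`: a real-valued function `μ` on the bounded Borel sets such that
`A ↦ μ (A ∩ K)` is a (finite) signed Borel measure for every compact `K`.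
(Every finite signed Borel measure on `ℝ` is Radon.) -/
@[ext]
structure LocalMeasure where
  toFun : BoundedBorel → ℝ
  exists_restrict : ∀ (K : Set ℝ) (hK : IsCompact K), ∃ s : SignedMeasure ℝ,
    ∀ (A : Set ℝ) (hA : MeasurableSet A), s A = toFun (BoundedBorel.interCompact A K hA hK)

namespace LocalMeasure

/-- The signed measure `1_[a,b] μ`. -/
noncomputable def restrictIcc (μ : LocalMeasure) (a b : ℝ) : SignedMeasure ℝ :=
  (μ.exists_restrict (Icc a b) isCompact_Icc).choose

theorem restrictIcc_apply (μ : LocalMeasure) (a b : ℝ) (A : Set ℝ) (hA : MeasurableSet A) :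
    μ.restrictIcc a b A = μ.toFun (BoundedBorel.interCompact A (Icc a b) hA isCompact_Icc) :=
  (μ.exists_restrict (Icc a b) isCompact_Icc).choose_spec A hA

/-- The positive part of `μ`, a Radon measure on `ℝ`, glued from the positive parts of the
restrictions of `μ` to the disjoint intervals `(n, n + 1]`. -/
noncomputable def posPart (μ : LocalMeasure) : Measure ℝ :=
  Measure.sum fun n : ℤ =>
    (μ.restrictIcc n (n + 1)).toJordanDecomposition.posPart.restrict (Ioc (n : ℝ) (n + 1))

/-- The negative part of `μ`. -/
noncomputable def negPart (μ : LocalMeasure) : Measure ℝ :=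
  Measure.sum fun n : ℤ =>
    (μ.restrictIcc n (n + 1)).toJordanDecomposition.negPart.restrict (Ioc (n : ℝ) (n + 1))

/-- The total variation `|μ|`, a nonnegative Radon measure on `ℝ`. -/
noncomputable def variation (μ : LocalMeasure) : Measure ℝ := μ.posPart + μ.negPart

theorem isFiniteMeasureOnCompacts_sum (m : ℤ → Measure ℝ) [∀ n, IsFiniteMeasure (m n)] :
    IsFiniteMeasureOnCompacts
      (Measure.sum fun n : ℤ => (m n).restrict (Ioc (n : ℝ) (n + 1))) := by
  constructor
  intro K hK
  obtain ⟨R, hR⟩ := hK.isBounded.subset_closedBall 0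
  have hsub : K ⊆ Icc (-R) R := by
    rw [Real.closedBall_eq_Icc] at hR
    simpa using hR
  rw [Measure.sum_apply _ hK.measurableSet, tsum_eq_sum (s := Finset.Icc (⌊-R⌋ - 1) ⌈R⌉)]
  · exact ENNReal.sum_lt_top.2 fun n _ => measure_lt_top _ _
  · intro n hn
    rw [Measure.restrict_apply hK.measurableSet]
    have : K ∩ Ioc (n : ℝ) (n + 1) = ∅ := by
      ext x
      simp only [mem_inter_iff, mem_Ioc, mem_empty_iff_false, iff_false, not_and]
      intro hx hnx hxn
      have hx' := hsub hx
      apply hn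
      rw [Finset.mem_Icc]
      constructor
      · have h1 : (⌊-R⌋ : ℝ) ≤ -R := Int.floor_le _
        have : (⌊-R⌋ : ℝ) ≤ ((n + 1 : ℤ) : ℝ) := by
          push_cast
          linarith [hx'.1]
        have := Int.cast_le.1 this
        linarith
      · have h1 : R ≤ (⌈R⌉ : ℝ) := Int.le_ceil _
        have : (n : ℝ) ≤ (⌈R⌉ : ℝ) := by linarith [hx'.2]
        exact Int.cast_le.1 this
    rw [this, measure_empty]

instance (μ : LocalMeasure) : IsFiniteMeasureOnCompacts μ.posPart :=
  isFiniteMeasureOnCompacts_sum _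

instance (μ : LocalMeasure) : IsFiniteMeasureOnCompacts μ.negPart :=
  isFiniteMeasureOnCompacts_sum _

/-- The integral `∫ f dμ`; it is used only for continuous `f` with compact support. -/
noncomputable def integral {E : Type*} [NormedAddCommGroup E] [NormedSpace ℝ E]
    (μ : LocalMeasure) (f : ℝ → E) : E :=
  ∫ x, f x ∂μ.posPart - ∫ x, f x ∂μ.negPart

/-- `‖μ‖_lu = sup_{a ∈ ℝ} |μ|((a, a + 1])`, with values in `[0, ∞]`. -/
noncomputable def luNorm (μ : LocalMeasure) : ℝ≥0∞ :=
  ⨆ a : ℝ, μ.variation (Ioc a (a + 1))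

/-- The space of uniformly locally bounded local measures. -/
def uniformlyLocallyBounded : Set LocalMeasure := {μ | μ.luNorm < ∞}

/-- The vague topology: the coarsest one that makes `μ ↦ ∫ φ dμ` continuous for each continuous
compactly supported `φ : ℝ → ℝ`. -/
noncomputable instance vagueTopology : TopologicalSpace LocalMeasure :=
  TopologicalSpace.induced (fun (μ : LocalMeasure) (φ : C_c(ℝ, ℝ)) => μ.integral φ) inferInstance

/-- The Borel σ-algebra of the vague topology. -/
noncomputable instance : MeasurableSpace LocalMeasure := borel LocalMeasure

instance : BorelSpace LocalMeasure := ⟨rfl⟩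

/-- The translated set `B + t`. -/
def _root_.BoundedBorel.translate (t : ℝ) (B : BoundedBorel) : BoundedBorel :=
  ⟨(fun x => x - t) ⁻¹' B.1, by
    have h : (fun x : ℝ => x - t) ⁻¹' B.1 = (fun x => x + t) '' B.1 := by
      ext x
      simp [sub_eq_add_neg]
    rw [h]
    exact (LipschitzWith.of_edist_le (f := fun x : ℝ => x + t)
      (fun x y => by simp)).isBounded_image B.2.1,
    (measurable_id.sub_const t) B.2.2⟩

/-- The translation `α_t μ = μ(· + t)`, that is `(α_t μ)(B) = μ(B + t)`. -/
def translate (t : ℝ) (μ : LocalMeasure) : LocalMeasure where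
  toFun B := μ.toFun (B.translate t)
  exists_restrict K hK := by
    have hK' : IsCompact ((fun x : ℝ => x - t) ⁻¹' K) := by
      have h : (fun x : ℝ => x - t) ⁻¹' K = (fun x => x + t) '' K := by
        ext x
        simp [sub_eq_add_neg]
      rw [h]
      exact hK.image (continuous_add_const t)
    obtain ⟨s, hs⟩ := μ.exists_restrict _ hK'
    have hm : Measurable fun x : ℝ => x - t := measurable_id.sub_const t
    refine ⟨s.map fun x => x - t, fun A hA => ?_⟩
    rw [VectorMeasure.map_apply _ hm hA, hs _ (hm hA)]
    rfl

/-- The distributional identity `-u'' + u μ = f` on `ℝ`, for continuous `u` and locally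
integrable `f`. -/
def WeakEquation (μ : LocalMeasure) (u f : ℝ → ℂ) : Prop :=
  ∀ φ : ℝ → ℂ, ContDiff ℝ ((⊤ : ℕ∞) : WithTop ℕ∞) φ → HasCompactSupport φ →
    -(∫ x, u x * iteratedDeriv 2 φ x) + μ.integral (fun x => u x * φ x) = ∫ x, f x * φ x

/-- The graph of `H_μ`: the pairs `(u, f)` in `L²(ℝ) × L²(ℝ)` such that `u` has a continuous
representative `v` with `-v'' + v μ = f` in the sense of distributions. -/
noncomputable def schrodingerGraph (μ : LocalMeasure) :
    Submodule ℂ (Lp ℂ 2 (volume : Measure ℝ) × Lp ℂ 2 (volume : Measure ℝ)) where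
  carrier := {p | ∃ v : ℝ → ℂ, Continuous v ∧ p.1 =ᵐ[volume] v ∧ μ.WeakEquation v p.2}
  zero_mem' := by
    refine ⟨0, continuous_zero, Lp.coeFn_zero _ _ _, fun φ _ _ => ?_⟩
    have h : ∫ x, (((0 : Lp ℂ 2 (volume : Measure ℝ)) : ℝ → ℂ) x) * φ x = 0 := by
      rw [← integral_zero ℝ ℂ]
      refine integral_congr_ae ?_
      filter_upwards [Lp.coeFn_zero ℂ 2 (volume : Measure ℝ)] with x hx
      rw [hx, Pi.zero_apply, zero_mul]
    change _ = ∫ x, (((0 : Lp ℂ 2 (volume : Measure ℝ)) : ℝ → ℂ) x) * φ x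
    rw [h]
    simp [LocalMeasure.integral]
  add_mem' := by
    rintro ⟨u₁, f₁⟩ ⟨u₂, f₂⟩ ⟨v₁, hc₁, he₁, hw₁⟩ ⟨v₂, hc₂, he₂, hw₂⟩
    refine ⟨v₁ + v₂, hc₁.add hc₂, (Lp.coeFn_add _ _).trans (he₁.add he₂), fun φ hφ hs => ?_⟩
    have hL : ∀ f : Lp ℂ 2 (volume : Measure ℝ), Integrable (fun x => f x * φ x) := by
      intro f
      have h2 : MemLp φ 2 (volume : Measure ℝ) := hφ.continuous.memLp_of_hasCompactSupport hs
      exact (Lp.memLp f).integrable_mul h2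
    have hv : ∀ v : ℝ → ℂ, Continuous v → ∀ ψ : ℝ → ℂ, Continuous ψ → HasCompactSupport ψ →
        ∀ m : Measure ℝ, IsFiniteMeasureOnCompacts m → Integrable (fun x => v x * ψ x) m := by
      intro v hv ψ hψ hψs m hm
      exact (hv.mul hψ).integrable_of_hasCompactSupport hψs.mul_left
    have hd : Continuous (iteratedDeriv 2 φ) := (contDiff_infty.1 hφ 2).continuous_iteratedDeriv 2 (by simp)
    have hds : HasCompactSupport (iteratedDeriv 2 φ) := by
      rw [iteratedDeriv_succ, iteratedDeriv_one]
      exact hs.deriv.deriv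
    have h1 := hw₁ φ hφ hs
    have h2 := hw₂ φ hφ hs
    have h3 : ∫ x, ((f₁ + f₂ : Lp ℂ 2 (volume : Measure ℝ)) : ℝ → ℂ) x * φ x
        = (∫ x, f₁ x * φ x) + ∫ x, f₂ x * φ x := by
      rw [← integral_add (hL f₁) (hL f₂)]
      refine integral_congr_ae ?_
      filter_upwards [Lp.coeFn_add f₁ f₂] with x hx
      rw [hx, Pi.add_apply, add_mul]
    change _ = ∫ x, ((f₁ + f₂ : Lp ℂ 2 (volume : Measure ℝ)) : ℝ → ℂ) x * φ x
    rw [h3]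
    simp only [LocalMeasure.integral, Pi.add_apply, add_mul] at h1 h2 ⊢
    rw [integral_add (hv v₁ hc₁ _ hd hds _ inferInstance) (hv v₂ hc₂ _ hd hds _ inferInstance),
      integral_add (hv v₁ hc₁ _ hφ.continuous hs μ.posPart inferInstance)
        (hv v₂ hc₂ _ hφ.continuous hs μ.posPart inferInstance),
      integral_add (hv v₁ hc₁ _ hφ.continuous hs μ.negPart inferInstance)
        (hv v₂ hc₂ _ hφ.continuous hs μ.negPart inferInstance), ← h1, ← h2]
    ring
  smul_mem' := by
    rintro c ⟨u, f⟩ ⟨v, hc, he, hw⟩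
    refine ⟨c • v, hc.const_smul c, (Lp.coeFn_smul _ _).trans (he.const_smul c), fun φ hφ hs => ?_⟩
    have h1 := hw φ hφ hs
    have h3 : ∫ x, ((c • f : Lp ℂ 2 (volume : Measure ℝ)) : ℝ → ℂ) x * φ x
        = c * ∫ x, f x * φ x := by
      rw [← integral_const_mul]
      refine integral_congr_ae ?_
      filter_upwards [Lp.coeFn_smul c f] with x hx
      rw [hx, Pi.smul_apply, smul_eq_mul, mul_assoc]
    change _ = ∫ x, ((c • f : Lp ℂ 2 (volume : Measure ℝ)) : ℝ → ℂ) x * φ x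
    rw [h3]
    simp only [LocalMeasure.integral, Pi.smul_apply, smul_eq_mul, mul_assoc] at h1 ⊢
    rw [integral_const_mul, integral_const_mul, integral_const_mul, ← h1]
    ring

/-- `schrodingerGraph μ` is the graph of an operator. -/
theorem schrodingerGraph_singleValued (μ : LocalMeasure)
    (p : Lp ℂ 2 (volume : Measure ℝ) × Lp ℂ 2 (volume : Measure ℝ))
    (hp : p ∈ μ.schrodingerGraph) (h0 : p.1 = 0) : p.2 = 0 := by
  obtain ⟨v, hc, he, hw⟩ := hp
  have hv : v = 0 := by
    have h : v =ᵐ[volume] (0 : ℝ → ℂ) := by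
      rw [h0] at he
      exact he.symm.trans (Lp.coeFn_zero _ _ _)
    exact (hc.ae_eq_iff_eq volume continuous_zero).1 h
  subst hv
  rw [Lp.eq_zero_iff_ae_eq_zero]
  refine ae_eq_zero_of_integral_contDiff_smul_eq_zero
    ((Lp.memLp p.2).locallyIntegrable (by norm_num)) fun g hg hgs => ?_
  have h := hw (fun x => (g x : ℂ)) (Complex.ofRealCLM.contDiff.comp hg)
    (hgs.comp_left (g := fun y : ℝ => (y : ℂ)) Complex.ofReal_zero)
  simp only [LocalMeasure.integral, Pi.zero_apply, zero_mul, integral_zero, sub_self, neg_zero,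
    add_zero] at h
  rw [h]
  refine integral_congr_ae (Eventually.of_forall fun x => ?_)
  simp [mul_comm]

/-- The Schrödinger operator `H_μ = -Δ + μ` in `L²(ℝ)`: the maximal operator, with domain
`{u ∈ L²(ℝ) ∩ C(ℝ) : -u'' + u μ ∈ L²(ℝ)}` and `H_μ u = -u'' + u μ`. -/
noncomputable def schrodinger (μ : LocalMeasure) :
    Lp ℂ 2 (volume : Measure ℝ) →ₗ.[ℂ] Lp ℂ 2 (volume : Measure ℝ) :=
  μ.schrodingerGraph.toLinearPMap

theorem schrodinger_graph (μ : LocalMeasure) : μ.schrodinger.graph = μ.schrodingerGraph :=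
  Submodule.toLinearPMap_graph_eq _ fun p hp h0 => μ.schrodingerGraph_singleValued p hp h0

end LocalMeasure

/-- The set of eigenvalues of a partially defined linear operator. -/
def LinearPMap.pointSpectrum {E : Type*} [AddCommGroup E] [Module ℂ E] (H : E →ₗ.[ℂ] E) : Set ℂ :=
  {z | ∃ u : H.domain, u ≠ 0 ∧ H u = z • (u : E)}

/-- A set `Ω` of local measures on which the potentials live: bounded with respect to `‖·‖_lu`,
closed with respect to the vague topology in the space of uniformly locally bounded local
measures, and invariant under translations. -/
structure IsPotentialSpace (Ω : Set LocalMeasure) : Prop where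
  subset : Ω ⊆ LocalMeasure.uniformlyLocallyBounded
  bounded : ∃ C : ℝ≥0∞, C < ∞ ∧ ∀ ω ∈ Ω, ω.luNorm ≤ C
  closed : IsClosed ((↑) ⁻¹' Ω : Set LocalMeasure.uniformlyLocallyBounded)
  translate_mem : ∀ t : ℝ, MapsTo (LocalMeasure.translate t) Ω Ω

namespace IsPotentialSpace

/-- The action `α_t` of `t ∈ ℝ` on `Ω`. -/
def shift {Ω : Set LocalMeasure} (hΩ : IsPotentialSpace Ω) (t : ℝ) : Ω → Ω :=
  (hΩ.translate_mem t).restrict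

/-- `P` is an ergodic measure for `(Ω, α)`: an `α`-invariant Borel probability measure for which
every `α`-invariant Borel set has measure `0` or `1`. -/
structure IsErgodic {Ω : Set LocalMeasure} (hΩ : IsPotentialSpace Ω) (P : Measure Ω) : Prop where
  isProbabilityMeasure : IsProbabilityMeasure P
  measurePreserving : ∀ t : ℝ, MeasurePreserving (hΩ.shift t) P P
  zero_one : ∀ A : Set Ω, MeasurableSet A → (∀ t : ℝ, hΩ.shift t ⁻¹' A = A) → P A = 0 ∨ P A = 1

/-- The set of `ω ∈ Ω` with `1_[0,p] ω = 1_[0,p] α_p ω = 1_[0,p] α_{-p} ω`. -/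
def gordonSet {Ω : Set LocalMeasure} (hΩ : IsPotentialSpace Ω) (p : ℝ) : Set Ω :=
  {ω | ω.1.restrictIcc 0 p = (hΩ.shift p ω).1.restrictIcc 0 p ∧
    (hΩ.shift p ω).1.restrictIcc 0 p = (hΩ.shift (-p) ω).1.restrictIcc 0 p}

/-- Condition (K). -/
def ConditionK {Ω : Set LocalMeasure} (hΩ : IsPotentialSpace Ω) (P : Measure Ω) : Prop :=
  ∃ p : ℕ → ℝ, (∀ n, 0 < p n) ∧ Tendsto p atTop atTop ∧
    0 < limsup (fun n => P (hΩ.gordonSet (p n))) atTop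

end IsPotentialSpace

/-! This is Gordon's argument combined with ergodicity. An eigenfunction `u` for `z` satisfies `u' =
w`, `dw = u d(μ - z dx)`. The complex measure `μ - z dx` is written as `g dm` with one positive
measure `m` (`dominating`) and a locally integrable density `g` (`coeff`), so that atoms, signs and
complex `z` need no separate treatment. `exists_isQuasiSolution` passes from distributions to this
integrated system, whose solutions have constant Wronskians (`wronskian_eq`) and are determined by
`(u, w)` at one point (`eq_zero`).

Suppose `μ` has period `p` on nearly three periods around the origin. There `u`, `u(· + p)` and `u(·
+ 2p)` solve the same equation, and the solution space is two-dimensional. The resulting linear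
relation bounds `‖u‖` on a fixed interval by the sum of its values at two points displaced by `±p`
or `2p` (`norm_le_or_norm_le`). If this happens for infinitely many `p n → ∞`, square integrability
makes the right side vanish in the limit, so `u` is zero on an interval and hence everywhere.
Self-adjointness and real `z` play no role.

Condition (K) provides this periodicity only with positive probability. Allowing a loss `N` at the
ends of the window, for an arbitrary `N`, makes the event translation invariant
(`asymptoticallyPeriodicSet`), and testing periodicity against continuous functions makes it Borel
for the vague topology. Ergodicity then raises its probability to one
(`ae_mem_asymptoticallyPeriodicSet`). -/

/-! ### The integrated system: integration by parts, Wronskian, uniqueness. -/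

theorem MeasureTheory.LocallyIntegrable.intervalIntegrable_of_real {m : Measure ℝ} {g : ℝ → ℂ}
    (hg : LocallyIntegrable g m) (s t : ℝ) : IntervalIntegrable g m s t :=
  (hg.integrableOn_isCompact isCompact_uIcc).intervalIntegrable

/-- Fubini on the triangle `s < y < x ≤ t`. -/
theorem intervalIntegral_primitive_mul {m : Measure ℝ} [IsLocallyFiniteMeasure m] {f h : ℝ → ℂ}
    {s t : ℝ} (hst : s ≤ t) (hf : IntervalIntegrable f volume s t)
    (hh : IntervalIntegrable h m s t) :
    ∫ x in s..t, (∫ y in s..x, f y) * h x ∂m = ∫ y in s..t, f y * ∫ x in y..t, h x ∂m := by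
  have hf' := (intervalIntegrable_iff_integrableOn_Ioc_of_le hst).1 hf
  have hh' := (intervalIntegrable_iff_integrableOn_Ioc_of_le hst).1 hh
  have hset : MeasurableSet {q : ℝ × ℝ | q.2 < q.1} := measurableSet_lt measurable_snd measurable_fst
  have hint : Integrable (Function.uncurry fun x y : ℝ =>
      {q : ℝ × ℝ | q.2 < q.1}.indicator (fun q => f q.2 * h q.1) (x, y))
      ((m.restrict (Ioc s t)).prod (volume.restrict (Ioc s t))) := by
    have h1 := (hh'.mul_prod hf').indicator hset
    refine h1.congr (Eventually.of_forall fun q => ?_)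
    simp only [Function.uncurry, indicator, mul_comm]
  have key := integral_integral_swap hint
  rw [intervalIntegral.integral_of_le hst, intervalIntegral.integral_of_le hst]
  have hL : ∀ x ∈ Ioc s t, (∫ y in s..x, f y) * h x
      = ∫ y in Ioc s t, {q : ℝ × ℝ | q.2 < q.1}.indicator (fun q => f q.2 * h q.1) (x, y) := by
    intro x hx
    -- The diagonal may be dropped because the inner variable carries Lebesgue measure; atoms of `m`
    -- are therefore harmless.
    rw [intervalIntegral.integral_of_le hx.1.le, integral_Ioc_eq_integral_Ioo, ← integral_mul_const]
    have : ∀ y, {q : ℝ × ℝ | q.2 < q.1}.indicator (fun q => f q.2 * h q.1) (x, y)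
        = (Iio x).indicator (fun y => f y * h x) y := fun y => rfl
    simp_rw [this]
    rw [setIntegral_indicator measurableSet_Iio]
    congr 2
    ext y
    simp only [mem_Ioo, mem_inter_iff, mem_Ioc, mem_Iio]
    exact ⟨fun hy => ⟨⟨hy.1, hy.2.le.trans hx.2⟩, hy.2⟩, fun hy => ⟨hy.1.1, hy.2⟩⟩
  have hR : ∀ y ∈ Ioc s t, f y * ∫ x in y..t, h x ∂m
      = ∫ x in Ioc s t, {q : ℝ × ℝ | q.2 < q.1}.indicator (fun q => f q.2 * h q.1) (x, y) ∂m := by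
    intro y hy
    rw [intervalIntegral.integral_of_le hy.2, ← integral_const_mul]
    have : ∀ x, {q : ℝ × ℝ | q.2 < q.1}.indicator (fun q => f q.2 * h q.1) (x, y)
        = (Ioi y).indicator (fun x => f y * h x) x := fun x => rfl
    simp_rw [this]
    rw [setIntegral_indicator measurableSet_Ioi]
    congr 2
    ext x
    simp only [mem_inter_iff, mem_Ioc, mem_Ioi]
    exact ⟨fun hx => ⟨⟨hy.1.trans hx.1, hx.2⟩, hx.1⟩, fun hx => ⟨hx.2, hx.1.2⟩⟩
  rw [setIntegral_congr_fun measurableSet_Ioc hL, setIntegral_congr_fun measurableSet_Ioc hR]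
  exact key

/-- `(u, w)` is a solution on `[a, b]` of the system `u' = w`, `dw = g u dm`. -/
structure IsQuasiSolution (m : Measure ℝ) (g : ℝ → ℂ) (a b : ℝ) (u w : ℝ → ℂ) : Prop where
  continuous : Continuous u
  intervalIntegrable : IntervalIntegrable w volume a b
  sub_eq : ∀ s ∈ Icc a b, ∀ t ∈ Icc a b, u t - u s = ∫ x in s..t, w x
  deriv_sub_eq : ∀ s ∈ Icc a b, ∀ t ∈ Icc a b, w t - w s = ∫ x in s..t, g x * u x ∂m

namespace IsQuasiSolution

variable {m : Measure ℝ} {g : ℝ → ℂ} {a b c d : ℝ} {u w u' w' : ℝ → ℂ}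

theorem le_mono (h : IsQuasiSolution m g a b u w) (hac : a ≤ c) (hcd : c ≤ d) (hdb : d ≤ b) :
    IsQuasiSolution m g c d u w where
  continuous := h.continuous
  intervalIntegrable := h.intervalIntegrable.mono_set (by
    rw [uIcc_of_le hcd, uIcc_of_le (hac.trans (hcd.trans hdb))]
    exact Icc_subset_Icc hac hdb)
  sub_eq s hs t ht := h.sub_eq s (Icc_subset_Icc hac hdb hs) t (Icc_subset_Icc hac hdb ht)
  deriv_sub_eq s hs t ht := h.deriv_sub_eq s (Icc_subset_Icc hac hdb hs) t (Icc_subset_Icc hac hdb ht)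

theorem intervalIntegrable_coeff [IsLocallyFiniteMeasure m] (hg : LocallyIntegrable g m)
    (hu : Continuous u) (s t : ℝ) : IntervalIntegrable (fun x => g x * u x) m s t :=
  (hg.mul_continuous hu).intervalIntegrable_of_real s t

theorem intervalIntegrable_of_mem (h : IsQuasiSolution m g a b u w) {s t : ℝ} (hs : s ∈ Icc a b)
    (ht : t ∈ Icc a b) : IntervalIntegrable w volume s t :=
  h.intervalIntegrable.mono_set (by
    rw [uIcc_of_le (hs.1.trans hs.2)]
    exact uIcc_subset_Icc hs ht)

theorem sub_const_mul [IsLocallyFiniteMeasure m] (hg : LocallyIntegrable g m)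
    (h : IsQuasiSolution m g a b u w) (h' : IsQuasiSolution m g a b u' w') (k : ℂ) :
    IsQuasiSolution m g a b (fun x => u x - k * u' x) (fun x => w x - k * w' x) where
  continuous := h.continuous.sub (continuous_const.mul h'.continuous)
  intervalIntegrable := h.intervalIntegrable.sub (h'.intervalIntegrable.const_mul k)
  sub_eq s hs t ht := by
    rw [intervalIntegral.integral_sub (h.intervalIntegrable_of_mem hs ht)
      ((h'.intervalIntegrable_of_mem hs ht).const_mul k), intervalIntegral.integral_const_mul,
      ← h.sub_eq s hs t ht, ← h'.sub_eq s hs t ht]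
    ring
  deriv_sub_eq s hs t ht := by
    have e : ∀ x, g x * (u x - k * u' x) = g x * u x - k * (g x * u' x) := fun x => by ring
    simp_rw [e]
    rw [intervalIntegral.integral_sub (intervalIntegrable_coeff hg h.continuous s t)
      ((intervalIntegrable_coeff hg h'.continuous s t).const_mul k),
      intervalIntegral.integral_const_mul,
      ← h.deriv_sub_eq s hs t ht, ← h'.deriv_sub_eq s hs t ht]
    ring

/-- Since `w` jumps at atoms of `m`, boundedness cannot come from continuity; it comes from the
finite variation of `w`. -/
theorem exists_norm_le [IsLocallyFiniteMeasure m] (hg : LocallyIntegrable g m)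
    (h : IsQuasiSolution m g a b u w) : ∃ C, ∀ x ∈ Icc a b, ‖w x‖ ≤ C := by
  refine ⟨‖w a‖ + ∫ x in a..b, ‖g x * u x‖ ∂m, fun x hx => ?_⟩
  have ha : a ∈ Icc a b := ⟨le_rfl, hx.1.trans hx.2⟩
  have h1 := h.deriv_sub_eq a ha x hx
  have h2 : ‖∫ x in a..x, g x * u x ∂m‖ ≤ ∫ x in a..b, ‖g x * u x‖ ∂m :=
    (intervalIntegral.norm_integral_le_integral_norm hx.1).trans
      (intervalIntegral.integral_mono_interval le_rfl hx.1 hx.2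
        (Eventually.of_forall fun _ => norm_nonneg _)
        (intervalIntegrable_coeff hg h.continuous a b).norm)
  rw [← h1] at h2
  have h3 : w x = w a + (w x - w a) := by ring
  rw [h3]
  exact (norm_add_le _ _).trans (by linarith)

theorem intervalIntegrable_mul [IsLocallyFiniteMeasure m] (hg : LocallyIntegrable g m)
    (hab : a ≤ b)
    (h : IsQuasiSolution m g a b u w) (h' : IsQuasiSolution m g a b u' w') :
    IntervalIntegrable (fun x => w x * w' x) volume a b := by
  obtain ⟨C, hC⟩ := h.exists_norm_le hg
  have h1 := (intervalIntegrable_iff_integrableOn_Ioc_of_le hab).1 h.intervalIntegrable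
  have h2 := (intervalIntegrable_iff_integrableOn_Ioc_of_le hab).1 h'.intervalIntegrable
  rw [intervalIntegrable_iff_integrableOn_Ioc_of_le hab]
  refine Integrable.bdd_mul (c := C) h2 h1.aestronglyMeasurable ?_
  rw [ae_restrict_iff' measurableSet_Ioc]
  exact Eventually.of_forall fun x hx => hC x (Ioc_subset_Icc_self hx)

theorem integral_add_integral_eq [IsLocallyFiniteMeasure m] (hg : LocallyIntegrable g m)
    (hab : a ≤ b)
    (h : IsQuasiSolution m g a b u w) (h' : IsQuasiSolution m g a b u' w') :
    (∫ x in a..b, g x * u x * u' x ∂m) + ∫ x in a..b, w x * w' x = u b * w' b - u a * w' a := by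
  have ha : a ∈ Icc a b := ⟨le_rfl, hab⟩
  have hb : b ∈ Icc a b := ⟨hab, le_rfl⟩
  have hi := intervalIntegrable_coeff hg h'.continuous a b
  have key := intervalIntegral_primitive_mul hab h.intervalIntegrable hi
  have hL : ∫ x in a..b, (∫ y in a..x, w y) * (g x * u' x) ∂m
      = (∫ x in a..b, g x * u x * u' x ∂m) - u a * (w' b - w' a) := by
    have e : ∫ x in a..b, (∫ y in a..x, w y) * (g x * u' x) ∂m
        = ∫ x in a..b, (g x * u x * u' x - u a * (g x * u' x)) ∂m := by
      refine intervalIntegral.integral_congr fun x hx => ?_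
      rw [uIcc_of_le hab] at hx
      rw [← h.sub_eq a ha x hx]
      ring
    rw [e, intervalIntegral.integral_sub _ (hi.const_mul _), intervalIntegral.integral_const_mul,
      h'.deriv_sub_eq a ha b hb]
    have := intervalIntegrable_coeff hg (h.continuous.mul h'.continuous) a b
    refine this.congr fun x _ => ?_
    simp only [Pi.mul_apply, mul_assoc]
  have hR : ∫ y in a..b, w y * ∫ x in y..b, g x * u' x ∂m
      = (u b - u a) * w' b - ∫ x in a..b, w x * w' x := by
    have e : ∫ y in a..b, w y * ∫ x in y..b, g x * u' x ∂m
        = ∫ y in a..b, (w y * w' b - w y * w' y) := by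
      refine intervalIntegral.integral_congr fun x hx => ?_
      rw [uIcc_of_le hab] at hx
      rw [← h'.deriv_sub_eq x hx b hb]
      ring
    rw [e, intervalIntegral.integral_sub (h.intervalIntegrable.mul_const _)
      (h.intervalIntegrable_mul hg hab h'), intervalIntegral.integral_mul_const,
      h.sub_eq a ha b hb]
  rw [hL, hR] at key
  linear_combination key

/-- The left side of `integral_add_integral_eq` is symmetric in the two solutions, so exchanging
them and subtracting leaves only boundary terms. -/
theorem wronskian_eq [IsLocallyFiniteMeasure m] (hg : LocallyIntegrable g m)
    (h : IsQuasiSolution m g a b u w) (h' : IsQuasiSolution m g a b u' w') {s t : ℝ}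
    (hs : s ∈ Icc a b) (ht : t ∈ Icc a b) :
    u s * w' s - u' s * w s = u t * w' t - u' t * w t := by
  wlog hst : s ≤ t generalizing s t
  · exact (this ht hs (le_of_not_ge hst)).symm
  have k := h.le_mono hs.1 hst ht.2
  have k' := h'.le_mono hs.1 hst ht.2
  have h1 := k.integral_add_integral_eq hg hst k'
  have h2 := k'.integral_add_integral_eq hg hst k
  have e1 : ∫ x in s..t, g x * u' x * u x ∂m = ∫ x in s..t, g x * u x * u' x ∂m := by
    congr 1; ext x; ring
  have e2 : ∫ x in s..t, w' x * w x = ∫ x in s..t, w x * w' x := by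
    congr 1; ext x; ring
  rw [e1, e2] at h2
  linear_combination h1 - h2

/-- With zero data at `s`, the maximum `M` of `‖u‖` between `s` and `t` obeys `M ≤ r K M`, where `K`
is the mass of `‖g‖ dm` on the whole interval. Smallness comes from the step length `r` alone, so
large atoms are allowed; `eq_zero` chains such steps. -/
theorem eq_zero_of_abs_sub_le [IsLocallyFiniteMeasure m] (hg : LocallyIntegrable g m)
    (h : IsQuasiSolution m g a b u w) {s t r : ℝ}
    (hr : r * (∫ x in a..b, ‖g x‖ ∂m) < 1)
    (hs : s ∈ Icc a b) (ht : t ∈ Icc a b) (hst : |t - s| ≤ r) (hu : u s = 0) (hw : w s = 0) :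
    u t = 0 ∧ w t = 0 := by
  have hab := hs.1.trans hs.2
  have hsub : uIcc s t ⊆ Icc a b := uIcc_subset_Icc hs ht
  have hr0 : 0 ≤ r := (abs_nonneg _).trans hst
  set K := ∫ x in a..b, ‖g x‖ ∂m with hK
  obtain ⟨x₀, hx₀, hmax⟩ := isCompact_uIcc.exists_isMaxOn (nonempty_uIcc (a := s) (b := t))
    h.continuous.norm.continuousOn
  have hM : ∀ x ∈ uIcc s t, ‖u x‖ ≤ ‖u x₀‖ := fun x hx => hmax hx
  have hwb : ∀ x ∈ uIcc s t, ‖w x‖ ≤ K * ‖u x₀‖ := by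
    intro x hx
    have h1 := h.deriv_sub_eq s hs x (hsub hx)
    rw [hw, sub_zero] at h1
    have hsx : uIoc s x ⊆ uIcc s t :=
      uIoc_subset_uIcc.trans (uIcc_subset_uIcc left_mem_uIcc hx)
    have hsx' : uIoc s x ⊆ Ioc a b := by
      intro y hy
      rw [mem_uIoc] at hy
      rcases hy with hy | hy
      · exact ⟨hs.1.trans_lt hy.1, hy.2.trans (hsub hx).2⟩
      · exact ⟨(hsub hx).1.trans_lt hy.1, hy.2.trans hs.2⟩
    have hgi : IntegrableOn (fun y => ‖g y‖) (Ioc a b) m :=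
      (intervalIntegrable_iff_integrableOn_Ioc_of_le hab).1 (hg.intervalIntegrable_of_real a b).norm
    rw [h1]
    calc ‖∫ y in s..x, g y * u y ∂m‖ ≤ ∫ y in uIoc s x, ‖g y * u y‖ ∂m :=
          intervalIntegral.norm_integral_le_integral_norm_uIoc
      _ ≤ ∫ y in uIoc s x, ‖g y‖ * ‖u x₀‖ ∂m := by
          refine setIntegral_mono_on ?_ ((hgi.mono_set hsx').mul_const _) measurableSet_uIoc
            fun y hy => ?_
          · exact (intervalIntegrable_iff.1 (intervalIntegrable_coeff hg h.continuous s x)).norm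
          · rw [norm_mul]
            gcongr
            exact hM y (hsx hy)
      _ = (∫ y in uIoc s x, ‖g y‖ ∂m) * ‖u x₀‖ := integral_mul_const _ _
      _ ≤ K * ‖u x₀‖ := by
          gcongr
          rw [hK, intervalIntegral.integral_of_le hab]
          exact setIntegral_mono_set hgi (Eventually.of_forall fun _ => norm_nonneg _)
            hsx'.eventuallyLE
  have hub : ‖u x₀‖ ≤ r * K * ‖u x₀‖ := by
    have h1 := h.sub_eq s hs x₀ (hsub hx₀)
    rw [hu, sub_zero] at h1
    have h2 : ‖∫ x in s..x₀, w x‖ ≤ K * ‖u x₀‖ * |x₀ - s| :=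
      intervalIntegral.norm_integral_le_of_norm_le_const fun x hx =>
        hwb x (uIoc_subset_uIcc.trans (uIcc_subset_uIcc left_mem_uIcc hx₀) hx)
    have h3 : |x₀ - s| ≤ r := (abs_sub_left_of_mem_uIcc hx₀).trans hst
    have hK0 : 0 ≤ K := intervalIntegral.integral_nonneg hab fun _ _ => norm_nonneg _
    calc ‖u x₀‖ ≤ K * ‖u x₀‖ * |x₀ - s| := h1 ▸ h2
      _ ≤ K * ‖u x₀‖ * r := by gcongr
      _ = r * K * ‖u x₀‖ := by ring
  have h0 : ‖u x₀‖ = 0 := by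
    by_contra hne
    have : 0 < ‖u x₀‖ := lt_of_le_of_ne (norm_nonneg _) (Ne.symm hne)
    nlinarith
  have h1 := hM t right_mem_uIcc
  have h2 := hwb t right_mem_uIcc
  rw [h0] at h1 h2
  rw [mul_zero] at h2
  exact ⟨norm_le_zero_iff.1 h1, norm_le_zero_iff.1 h2⟩

theorem eq_zero [IsLocallyFiniteMeasure m] (hg : LocallyIntegrable g m)
    (h : IsQuasiSolution m g a b u w) {s t : ℝ}
    (hs : s ∈ Icc a b) (ht : t ∈ Icc a b) (hu : u s = 0) (hw : w s = 0) :
    u t = 0 ∧ w t = 0 := by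
  set K := ∫ x in a..b, ‖g x‖ ∂m with hK
  have hK0 : 0 ≤ K :=
    intervalIntegral.integral_nonneg (hs.1.trans hs.2) fun _ _ => norm_nonneg _
  set r := 1 / (K + 1) with hr
  have hr0 : 0 < r := by positivity
  have hrK : r * K < 1 := by
    rw [hr, one_div, inv_mul_lt_iff₀ (by positivity)]
    linarith
  obtain ⟨n, hn⟩ := exists_nat_gt (|t - s| / r)
  have hn0 : (0 : ℝ) < n := (by positivity : (0 : ℝ) ≤ |t - s| / r).trans_lt hn
  have hstep : ∀ k : ℕ, k ≤ n → u (s + k * ((t - s) / n)) = 0 ∧ w (s + k * ((t - s) / n)) = 0 := by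
    have hmem : ∀ k : ℕ, k ≤ n → s + k * ((t - s) / n) ∈ Icc a b := by
      intro k hk
      have hk1 : (k : ℝ) / n ≤ 1 := div_le_one_of_le₀ (by exact_mod_cast hk) hn0.le
      have := (convex_Icc a b) hs ht (a := 1 - (k : ℝ) / n) (b := (k : ℝ) / n)
        (by linarith) (by positivity) (by ring)
      convert this using 1
      simp only [smul_eq_mul]
      ring
    intro k
    induction k with
    | zero => intro _; simpa using ⟨hu, hw⟩
    | succ k ih =>
      intro hk
      obtain ⟨h1, h2⟩ := ih (by omega)
      refine h.eq_zero_of_abs_sub_le hg hrK (hmem k (by omega)) (hmem (k + 1) hk) ?_ h1 h2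
      have e : s + ((k + 1 : ℕ) : ℝ) * ((t - s) / n) - (s + k * ((t - s) / n)) = (t - s) / n := by
        push_cast; ring
      rw [e, abs_div, abs_of_pos hn0, div_le_iff₀ hn0]
      rw [div_lt_iff₀ hr0] at hn
      linarith
  have := hstep n le_rfl
  have e : s + n * ((t - s) / n) = t := by field_simp; ring
  rwa [e] at this

/-- Where `u` vanishes, `dw = g u dm` vanishes too, so `w` is constant there, and `∫ w = 0` forces
that constant to be zero. -/
theorem eq_zero_of_eqOn_zero [IsLocallyFiniteMeasure m] (hg : LocallyIntegrable g m)
    (h : IsQuasiSolution m g a b u w) (hac : a ≤ c) (hcd : c < d) (hdb : d ≤ b)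
    (h0 : ∀ x ∈ Icc c d, u x = 0) {t : ℝ} (ht : t ∈ Icc a b) : u t = 0 := by
  have k := h.le_mono hac hcd.le hdb
  have hc : c ∈ Icc c d := left_mem_Icc.2 hcd.le
  have hw : ∀ x ∈ Icc c d, w x = w c := by
    intro x hx
    rw [← sub_eq_zero, k.deriv_sub_eq c hc x hx]
    rw [intervalIntegral.integral_congr (g := fun _ => 0), intervalIntegral.integral_zero]
    intro y hy
    rw [uIcc_of_le hx.1] at hy
    simp only
    rw [h0 y ⟨hy.1, hy.2.trans hx.2⟩, mul_zero]
  have h1 := k.sub_eq c hc d (right_mem_Icc.2 hcd.le)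
  rw [h0 c hc, h0 d (right_mem_Icc.2 hcd.le), intervalIntegral.integral_congr (g := fun _ => w c)
    (fun x hx => hw x (by rwa [uIcc_of_le hcd.le] at hx)), intervalIntegral.integral_const] at h1
  have hwc : w c = 0 := by
    have := h1.symm
    rw [sub_self, smul_eq_zero] at this
    exact this.resolve_left (by linarith)
  exact (h.eq_zero hg ⟨hac, hcd.le.trans hdb⟩ ht (h0 c hc) hwc).1

end IsQuasiSolution

/-! ### From the distributional equation to the integrated system. -/

theorem exists_contDiff_deriv_eq {χ : ℝ → ℂ} (hχ : ContDiff ℝ ((⊤ : ℕ∞) : WithTop ℕ∞) χ)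
    (hs : HasCompactSupport χ) (h0 : ∫ x, χ x = 0) :
    ∃ φ : ℝ → ℂ, ContDiff ℝ ((⊤ : ℕ∞) : WithTop ℕ∞) φ ∧ HasCompactSupport φ ∧ deriv φ = χ := by
  obtain ⟨R, hR⟩ := hs.isCompact.isBounded.subset_closedBall 0
  rw [Real.closedBall_eq_Icc, zero_sub, zero_add] at hR
  have hout : ∀ x, x ∉ Icc (-R) R → χ x = 0 := fun x hx =>
    image_eq_zero_of_notMem_tsupport fun h => hx (hR h)
  have hder : ∀ x, HasDerivAt (fun x => ∫ y in (-R - 1)..x, χ y) (χ x) x := fun x =>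
    intervalIntegral.integral_hasDerivAt_right (hχ.continuous.intervalIntegrable _ _)
      (hχ.continuous.stronglyMeasurableAtFilter _ _) hχ.continuous.continuousAt
  have hd : deriv (fun x => ∫ y in (-R - 1)..x, χ y) = χ := funext fun x => (hder x).deriv
  refine ⟨fun x => ∫ y in (-R - 1)..x, χ y, ?_, ?_, hd⟩
  · rw [contDiff_infty_iff_deriv, hd]
    exact ⟨fun x => (hder x).differentiableAt, hχ⟩
  · refine HasCompactSupport.intro (K := Icc (-R - 1) (R + 1)) isCompact_Icc fun x hx => ?_
    rw [mem_Icc, not_and_or, not_le, not_le] at hx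
    rcases hx with hx | hx
    · rw [intervalIntegral.integral_congr (g := fun _ => 0), intervalIntegral.integral_zero]
      intro y hy
      rw [uIcc_of_ge hx.le] at hy
      exact hout y fun h => by linarith [hy.2, h.1]
    · rw [intervalIntegral.integral_eq_integral_of_support_subset, h0]
      intro y hy
      have := not_imp_comm.1 (hout y) hy
      exact ⟨by linarith [this.1], by linarith [this.2]⟩

theorem exists_contDiff_integral_eq_one :
    ∃ η : ℝ → ℂ, ContDiff ℝ ((⊤ : ℕ∞) : WithTop ℕ∞) η ∧ HasCompactSupport η ∧ ∫ x, η x = 1 := by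
  let f : ContDiffBump (0 : ℝ) := ⟨1, 2, one_pos, one_lt_two⟩
  refine ⟨fun x => (f.normed volume x : ℂ), Complex.ofRealCLM.contDiff.comp f.contDiff_normed,
    f.hasCompactSupport_normed.comp_left (g := fun y : ℝ => (y : ℂ)) Complex.ofReal_zero, ?_⟩
  rw [integral_complex_ofReal, f.integral_normed, Complex.ofReal_one]

theorem Continuous.integrable_mul_of_hasCompactSupport {f ψ : ℝ → ℂ} (hf : Continuous f)
    (hψ : Continuous ψ) (hs : HasCompactSupport ψ) {m : Measure ℝ} [IsLocallyFiniteMeasure m] :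
    Integrable (fun x => f x * ψ x) m :=
  (hf.mul hψ).integrable_of_hasCompactSupport hs.mul_left

theorem eq_const_of_forall_integral_mul {f : ℝ → ℂ} (hf : Continuous f) (c : ℂ)
    (h : ∀ ψ : ℝ → ℂ, ContDiff ℝ ((⊤ : ℕ∞) : WithTop ℕ∞) ψ → HasCompactSupport ψ →
      ∫ x, f x * ψ x = c * ∫ x, ψ x) (x : ℝ) : f x = c := by
  have hc : Continuous fun x => f x - c := hf.sub continuous_const
  have : ∀ᵐ x, f x - c = 0 := by
    refine ae_eq_zero_of_integral_contDiff_smul_eq_zero hc.locallyIntegrable fun g hg hgs => ?_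
    have hg' : ContDiff ℝ ((⊤ : ℕ∞) : WithTop ℕ∞) fun x => (g x : ℂ) :=
      Complex.ofRealCLM.contDiff.comp hg
    have hgs' : HasCompactSupport fun x => (g x : ℂ) :=
      hgs.comp_left (g := fun y : ℝ => (y : ℂ)) Complex.ofReal_zero
    have h1 := h _ hg' hgs'
    have e : ∀ x, g x • (f x - c) = f x * (g x : ℂ) - c * (g x : ℂ) := fun x => by
      rw [Complex.real_smul]; ring
    simp_rw [e]
    rw [integral_sub (hf.integrable_mul_of_hasCompactSupport hg'.continuous hgs')
      (continuous_const.integrable_mul_of_hasCompactSupport hg'.continuous hgs'), h1,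
      integral_const_mul, sub_self]
  have h2 := (hc.ae_eq_iff_eq volume continuous_zero).1 this
  exact sub_eq_zero.1 (congrFun h2 x)

/-- A distribution with zero derivative is constant: subtracting `(∫ ψ) η` from `ψ`, where `∫ η =
1`, leaves a function of mean zero, which is the derivative of a test function. -/
theorem exists_forall_integral_mul_eq (T : (ℝ → ℂ) → ℂ)
    (hadd : ∀ (φ ψ : ℝ → ℂ) (k : ℂ), ContDiff ℝ ((⊤ : ℕ∞) : WithTop ℕ∞) φ → HasCompactSupport φ →
      ContDiff ℝ ((⊤ : ℕ∞) : WithTop ℕ∞) ψ → HasCompactSupport ψ →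
      T (fun x => φ x - k * ψ x) = T φ - k * T ψ)
    (hT : ∀ φ : ℝ → ℂ, ContDiff ℝ ((⊤ : ℕ∞) : WithTop ℕ∞) φ → HasCompactSupport φ →
      T (deriv φ) = 0) :
    ∃ c : ℂ, ∀ ψ : ℝ → ℂ, ContDiff ℝ ((⊤ : ℕ∞) : WithTop ℕ∞) ψ → HasCompactSupport ψ →
      T ψ = c * ∫ x, ψ x := by
  obtain ⟨η, hη, hηs, hη1⟩ := exists_contDiff_integral_eq_one
  refine ⟨T η, fun ψ hψ hψs => ?_⟩
  have hχ : ContDiff ℝ ((⊤ : ℕ∞) : WithTop ℕ∞) fun x => ψ x - (∫ y, ψ y) * η x :=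
    hψ.sub (contDiff_const.mul hη)
  have hχs : HasCompactSupport fun x => ψ x - (∫ y, ψ y) * η x := hψs.sub hηs.mul_left
  obtain ⟨φ, hφ, hφs, hd⟩ := exists_contDiff_deriv_eq hχ hχs (by
    rw [integral_sub (hψ.continuous.integrable_of_hasCompactSupport hψs)
      ((hη.continuous.integrable_of_hasCompactSupport hηs).const_mul _), integral_const_mul, hη1,
      mul_one, sub_self])
  have h1 := hT φ hφ hφs
  rw [hd, hadd ψ η _ hψ hψs hη hηs] at h1
  linear_combination h1

theorem integral_id_mul_deriv {φ : ℝ → ℂ} (hφ : ContDiff ℝ ((⊤ : ℕ∞) : WithTop ℕ∞) φ)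
    (hs : HasCompactSupport φ) : ∫ x : ℝ, (x : ℂ) * deriv φ x = -∫ x, φ x := by
  have hd := contDiff_infty_iff_deriv.1 hφ
  have := integral_mul_deriv_eq_deriv_mul_of_integrable (u := fun x : ℝ => (x : ℂ))
    (u' := fun _ => 1) (v := φ) (v' := deriv φ)
    (fun x _ => Complex.ofRealCLM.hasDerivAt) (fun x _ => (hd.1 x).hasDerivAt)
    (Complex.continuous_ofReal.integrable_mul_of_hasCompactSupport hd.2.continuous hs.deriv)
    (continuous_const.integrable_mul_of_hasCompactSupport hφ.continuous hs)
    (Complex.continuous_ofReal.integrable_mul_of_hasCompactSupport hφ.continuous hs)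
  simpa using this

theorem exists_affine_of_forall_integral_mul_deriv_deriv {k : ℝ → ℂ} (hk : Continuous k)
    (h : ∀ φ : ℝ → ℂ, ContDiff ℝ ((⊤ : ℕ∞) : WithTop ℕ∞) φ → HasCompactSupport φ →
      ∫ x, k x * deriv (deriv φ) x = 0) : ∃ c₀ c₁ : ℂ, ∀ x : ℝ, k x = c₀ + c₁ * x := by
  have hder : ∀ φ : ℝ → ℂ, ContDiff ℝ ((⊤ : ℕ∞) : WithTop ℕ∞) φ →
      Differentiable ℝ φ ∧ ContDiff ℝ ((⊤ : ℕ∞) : WithTop ℕ∞) (deriv φ) :=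
    fun φ hφ => contDiff_infty_iff_deriv.1 hφ
  obtain ⟨c, hc⟩ := exists_forall_integral_mul_eq (fun φ => ∫ x, k x * deriv φ x)
    (fun φ ψ l hφ hφs hψ hψs => by
      have e : ∀ x, deriv (fun x => φ x - l * ψ x) x = deriv φ x - l * deriv ψ x := fun x => by
        rw [deriv_fun_sub ((hder φ hφ).1 x) (((hder ψ hψ).1 x).const_mul l),
          deriv_const_mul_field]
      have e' : ∀ x, k x * (deriv φ x - l * deriv ψ x)
          = k x * deriv φ x - l * (k x * deriv ψ x) := fun x => by ring
      simp_rw [e, e']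
      rw [integral_sub
        (hk.integrable_mul_of_hasCompactSupport (hder φ hφ).2.continuous hφs.deriv)
        ((hk.integrable_mul_of_hasCompactSupport (hder ψ hψ).2.continuous hψs.deriv).const_mul l),
        integral_const_mul]) h
  have hk' : Continuous fun x : ℝ => k x + c * x :=
    hk.add (continuous_const.mul Complex.continuous_ofReal)
  obtain ⟨c₀, hc₀⟩ := exists_forall_integral_mul_eq (fun ψ => ∫ x, (k x + c * x) * ψ x)
    (fun φ ψ l hφ hφs hψ hψs => by
      have e : ∀ x : ℝ, (k x + c * x) * (φ x - l * ψ x)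
          = (k x + c * x) * φ x - l * ((k x + c * x) * ψ x) := fun x => by ring
      simp_rw [e]
      rw [integral_sub (hk'.integrable_mul_of_hasCompactSupport hφ.continuous hφs)
        ((hk'.integrable_mul_of_hasCompactSupport hψ.continuous hψs).const_mul l),
        integral_const_mul])
    (fun φ hφ hφs => by
      have e : ∀ x : ℝ, (k x + c * x) * deriv φ x = k x * deriv φ x + c * (x * deriv φ x) :=
        fun x => by ring
      simp_rw [e]
      rw [integral_add (hk.integrable_mul_of_hasCompactSupport (hder φ hφ).2.continuous hφs.deriv)
        ((Complex.continuous_ofReal.integrable_mul_of_hasCompactSupport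
          (hder φ hφ).2.continuous hφs.deriv).const_mul c), hc φ hφ hφs, integral_const_mul,
        integral_id_mul_deriv hφ hφs]
      ring)
  refine ⟨c₀, -c, fun x => ?_⟩
  have := eq_const_of_forall_integral_mul hk' c₀ hc₀ x
  linear_combination this

/-- The primitive may jump at atoms, so its measurability is obtained from that of parameter
integrals of jointly measurable functions. -/
theorem stronglyMeasurable_primitive {m : Measure ℝ} [IsLocallyFiniteMeasure m] {h : ℝ → ℂ}
    (hh : LocallyIntegrable h m) : StronglyMeasurable fun t => ∫ x in (0 : ℝ)..t, h x ∂m := by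
  obtain ⟨h', hm, he⟩ := hh.aestronglyMeasurable
  have e : ∀ t, ∫ x in (0 : ℝ)..t, h x ∂m
      = (∫ x, {q : ℝ × ℝ | 0 < q.2 ∧ q.2 ≤ q.1}.indicator (fun q => h' q.2) (t, x) ∂m)
        - ∫ x, {q : ℝ × ℝ | q.1 < q.2 ∧ q.2 ≤ 0}.indicator (fun q => h' q.2) (t, x) ∂m := by
    intro t
    rw [intervalIntegral, setIntegral_congr_ae₀ (g := h') measurableSet_Ioc.nullMeasurableSet
        (he.mono fun x hx _ => hx),
      setIntegral_congr_ae₀ (g := h') measurableSet_Ioc.nullMeasurableSet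
        (he.mono fun x hx _ => hx),
      ← integral_indicator measurableSet_Ioc, ← integral_indicator measurableSet_Ioc]
    rfl
  simp_rw [e]
  have hm' : StronglyMeasurable fun q : ℝ × ℝ => h' q.2 := hm.comp_measurable measurable_snd
  refine StronglyMeasurable.sub
    (StronglyMeasurable.integral_prod_right' (f := _) (hm'.indicator ?_))
    (StronglyMeasurable.integral_prod_right' (f := _) (hm'.indicator ?_))
  · exact (measurableSet_lt measurable_const measurable_snd).inter
      (measurableSet_le measurable_snd measurable_fst)
  · exact (measurableSet_lt measurable_fst measurable_snd).inter
      (measurableSet_le measurable_snd measurable_const)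

theorem locallyIntegrable_primitive {m : Measure ℝ} [IsLocallyFiniteMeasure m] {h : ℝ → ℂ}
    (hh : LocallyIntegrable h m) :
    LocallyIntegrable (fun t => ∫ x in (0 : ℝ)..t, h x ∂m) volume := by
  rw [locallyIntegrable_iff]
  intro K hK
  obtain ⟨R, hR⟩ := hK.isBounded.subset_closedBall 0
  rw [Real.closedBall_eq_Icc, zero_sub, zero_add] at hR
  refine Measure.integrableOn_of_bounded (M := ∫ x in Ioc (-R) R, ‖h x‖ ∂m)
    hK.measure_lt_top.ne (stronglyMeasurable_primitive hh).aestronglyMeasurable ?_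
  rw [ae_restrict_iff' hK.measurableSet]
  refine Eventually.of_forall fun t ht => ?_
  have ht' := hR ht
  refine intervalIntegral.norm_integral_le_integral_norm_uIoc.trans ?_
  refine setIntegral_mono_set ((hh.integrableOn_isCompact isCompact_Icc).mono_set
    Ioc_subset_Icc_self).norm (Eventually.of_forall fun _ => norm_nonneg _) ?_
  refine LE.le.eventuallyLE fun x (hx : x ∈ uIoc 0 t) => ?_
  rw [mem_uIoc] at hx
  rcases hx with hx | hx
  · exact ⟨by linarith [ht'.1, ht'.2], hx.2.trans ht'.2⟩
  · exact ⟨ht'.1.trans_lt hx.1, by linarith [ht'.1, ht'.2]⟩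

theorem integral_mul_eq_neg_integral_primitive_mul_deriv {m : Measure ℝ}
    [IsLocallyFiniteMeasure m] {h : ℝ → ℂ} (hh : LocallyIntegrable h m) {φ : ℝ → ℂ}
    (hφ : ContDiff ℝ ((⊤ : ℕ∞) : WithTop ℕ∞) φ) (hs : HasCompactSupport φ) :
    ∫ x, h x * φ x ∂m = -∫ t, (∫ x in (0 : ℝ)..t, h x ∂m) * deriv φ t := by
  obtain ⟨R, hR⟩ := hs.isCompact.isBounded.subset_closedBall 0
  rw [Real.closedBall_eq_Icc, zero_sub, zero_add] at hR
  have hd := contDiff_infty_iff_deriv.1 hφ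
  obtain ⟨A, hA, hA0⟩ : ∃ A, R < A ∧ 0 < A := ⟨max R 0 + 1, by linarith [le_max_left R 0],
    by linarith [le_max_right R 0]⟩
  have hsub : tsupport φ ⊆ Ioc (-A) A := fun x hx =>
    ⟨by linarith [(hR hx).1], by linarith [(hR hx).2]⟩
  have hout : ∀ x, x ∉ Ioc (-A) A → φ x = 0 := fun x hx =>
    image_eq_zero_of_notMem_tsupport fun h => hx (hsub h)
  have hout' : ∀ x, x ∉ Ioc (-A) A → deriv φ x = 0 := fun x hx =>
    image_eq_zero_of_notMem_tsupport fun h => hx (hsub (tsupport_deriv_subset h))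
  have hAA : -A ≤ A := by linarith
  have hprim : ∀ s t, ∫ y in s..t, deriv φ y = φ t - φ s := fun s t =>
    intervalIntegral.integral_deriv_eq_sub (fun x _ => hd.1 x)
      (hd.2.continuous.intervalIntegrable _ _)
  have hAl : φ (-A) = 0 := hout _ fun h => lt_irrefl _ h.1
  have hAr : φ A = 0 := image_eq_zero_of_notMem_tsupport fun h => by linarith [(hR h).2]
  have hF : ∀ y, ∫ x in y..A, h x ∂m
      = (∫ x in (0 : ℝ)..A, h x ∂m) - ∫ x in (0 : ℝ)..y, h x ∂m := fun y => by
    rw [intervalIntegral.integral_interval_sub_left (hh.intervalIntegrable_of_real _ _)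
      (hh.intervalIntegrable_of_real _ _)]
  have key := intervalIntegral_primitive_mul hAA
    (hd.2.continuous.intervalIntegrable (μ := volume) (-A) A)
    (hh.intervalIntegrable_of_real (-A) A)
  have hL : ∫ x in (-A)..A, (∫ y in (-A)..x, deriv φ y) * h x ∂m = ∫ x, h x * φ x ∂m := by
    simp_rw [hprim, hAl, sub_zero]
    rw [intervalIntegral.integral_eq_integral_of_support_subset]
    · simp_rw [mul_comm]
    · intro x hx
      by_contra hn
      exact hx (by simp only [hout x hn, zero_mul])
  have hR' : ∫ y in (-A)..A, deriv φ y * ∫ x in y..A, h x ∂m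
      = -∫ t, (∫ x in (0 : ℝ)..t, h x ∂m) * deriv φ t := by
    rw [intervalIntegral.integral_congr (g := fun y => deriv φ y * (∫ x in (0 : ℝ)..A, h x ∂m)
      - deriv φ y * ∫ x in (0 : ℝ)..y, h x ∂m) fun y _ => by simp only [hF y, mul_sub]]
    have hi : IntervalIntegrable (fun y => deriv φ y * ∫ x in (0 : ℝ)..y, h x ∂m) volume (-A) A := by
      have := ((locallyIntegrable_primitive hh).mul_continuous
        hd.2.continuous).intervalIntegrable_of_real (-A) A
      simpa only [mul_comm] using this
    have hi' : IntervalIntegrable (fun y => deriv φ y * ∫ x in (0 : ℝ)..A, h x ∂m)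
        volume (-A) A := (hd.2.continuous.mul continuous_const).intervalIntegrable _ _
    rw [intervalIntegral.integral_sub hi' hi,
      intervalIntegral.integral_mul_const, hprim, hAl, hAr, sub_zero, zero_mul, zero_sub,
      intervalIntegral.integral_eq_integral_of_support_subset]
    · simp_rw [mul_comm]
    · intro x hx
      by_contra hn
      exact hx (by simp only [hout' x hn, zero_mul])
  rw [← hL, key, hR']

/-- Let `F` be a primitive of `g u dm` and `G` one of `F`. Then `u - G` has zero second
distributional derivative and is affine with some slope `c₁`, so `w = F + c₁` works at every point,
not just almost everywhere. -/
theorem exists_isQuasiSolution {m : Measure ℝ} [IsLocallyFiniteMeasure m] {g u : ℝ → ℂ}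
    (hg : LocallyIntegrable g m) (hu : Continuous u)
    (h : ∀ φ : ℝ → ℂ, ContDiff ℝ ((⊤ : ℕ∞) : WithTop ℕ∞) φ → HasCompactSupport φ →
      ∫ x, u x * iteratedDeriv 2 φ x = ∫ x, g x * u x * φ x ∂m) :
    ∃ w : ℝ → ℂ, ∀ a b, IsQuasiSolution m g a b u w := by
  set F : ℝ → ℂ := fun t => ∫ x in (0 : ℝ)..t, g x * u x ∂m with hFdef
  have hgu : LocallyIntegrable (fun x => g x * u x) m := hg.mul_continuous hu
  have hF : LocallyIntegrable F volume := locallyIntegrable_primitive hgu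
  set G : ℝ → ℂ := fun t => ∫ x in (0 : ℝ)..t, F x with hGdef
  have hG : Continuous G := intervalIntegral.continuous_primitive
    (fun a b => hF.intervalIntegrable_of_real a b) 0
  obtain ⟨c₀, c₁, hc⟩ := exists_affine_of_forall_integral_mul_deriv_deriv (hu.sub hG)
    fun φ hφ hs => by
      have hd := contDiff_infty_iff_deriv.1 hφ
      have hd' := contDiff_infty_iff_deriv.1 hd.2
      have h1 := h φ hφ hs
      rw [iteratedDeriv_succ, iteratedDeriv_one,
        integral_mul_eq_neg_integral_primitive_mul_deriv hgu hφ hs,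
        integral_mul_eq_neg_integral_primitive_mul_deriv hF hd.2 hs.deriv, neg_neg] at h1
      simp only [Pi.sub_apply, sub_mul]
      rw [integral_sub (hu.integrable_mul_of_hasCompactSupport hd'.2.continuous hs.deriv.deriv)
        (hG.integrable_mul_of_hasCompactSupport hd'.2.continuous hs.deriv.deriv), h1, sub_self]
  refine ⟨fun x => F x + c₁, fun a b => ⟨hu, ?_, fun s _ t _ => ?_, fun s _ t _ => ?_⟩⟩
  · exact (hF.intervalIntegrable_of_real a b).add intervalIntegrable_const
  · rw [intervalIntegral.integral_add (hF.intervalIntegrable_of_real s t)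
      intervalIntegrable_const, intervalIntegral.integral_const, Complex.real_smul]
    have h1 := hc t
    have h2 := hc s
    simp only [Pi.sub_apply] at h1 h2
    have h3 : G t - G s = ∫ x in s..t, F x := intervalIntegral.integral_interval_sub_left
      (hF.intervalIntegrable_of_real _ _) (hF.intervalIntegrable_of_real _ _)
    rw [← h3]
    push_cast
    linear_combination h1 - h2
  · have h3 : F t - F s = ∫ x in s..t, g x * u x ∂m := intervalIntegral.integral_interval_sub_left
      (hgu.intervalIntegrable_of_real _ _) (hgu.intervalIntegrable_of_real _ _)
    rw [← h3]
    ring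

/-! ### The three-block estimate. -/

namespace IsQuasiSolution

variable {m : Measure ℝ} {g : ℝ → ℂ} {a b p L : ℝ} {u w : ℝ → ℂ}

/-- The hypothesis `hper` expresses periodicity of the product `g dm`; neither `g` nor `m` need be
periodic separately. -/
theorem comp_add_right
    (hper : ∀ f : ℝ → ℂ, Continuous f → ∀ s ∈ Icc a b, ∀ t ∈ Icc a b,
      ∫ x in s..t, g x * f (x + p) ∂m = ∫ x in (s + p)..(t + p), g x * f x ∂m)
    (h : IsQuasiSolution m g (a + p) (b + p) u w) :
    IsQuasiSolution m g a b (fun x => u (x + p)) (fun x => w (x + p)) := by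
  have hmem : ∀ s ∈ Icc a b, s + p ∈ Icc (a + p) (b + p) := fun s hs =>
    ⟨by linarith [hs.1], by linarith [hs.2]⟩
  refine ⟨h.continuous.comp (continuous_add_const p), ?_, fun s hs t ht => ?_, fun s hs t ht => ?_⟩
  · have := h.intervalIntegrable.comp_add_right p
    simpa using this
  · rw [intervalIntegral.integral_comp_add_right]
    exact h.sub_eq _ (hmem s hs) _ (hmem t ht)
  · rw [hper u h.continuous s hs t ht]
    exact h.deriv_sub_eq _ (hmem s hs) _ (hmem t ht)

/-- Gordon's three-block estimate, on a window that is slightly shorter than three periods. -/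
theorem norm_le_or_norm_le [IsLocallyFiniteMeasure m] (hg : LocallyIntegrable g m)
    (hL : 0 ≤ L) (hp : 2 * L + 1 ≤ p)
    (hper : ∀ f : ℝ → ℂ, Continuous f → ∀ s ∈ Icc (-p + L) (p - L), ∀ t ∈ Icc (-p + L) (p - L),
      ∫ x in s..t, g x * f (x + p) ∂m = ∫ x in (s + p)..(t + p), g x * f x ∂m)
    (h : ∀ a b, IsQuasiSolution m g a b u w) :
    (∀ x ∈ Icc (-L - 1) (-L), ‖u x‖ ≤ ‖u (x + p)‖ + ‖u (x + p + p)‖) ∨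
      ∀ x ∈ Icc L (L + 1), ‖u x‖ ≤ ‖u (x - p)‖ + ‖u (x + p)‖ := by
  have h1 : IsQuasiSolution m g (-p + L) (p - L) (fun x => u (x + p)) (fun x => w (x + p)) :=
    (h _ _).comp_add_right hper
  have h2 : IsQuasiSolution m g (-p + L) (-L) (fun x => u (x + p + p)) (fun x => w (x + p + p)) := by
    refine comp_add_right (u := fun x => u (x + p)) (w := fun x => w (x + p))
      (fun f hf s hs t ht => hper f hf s ⟨hs.1, by linarith [hs.2]⟩ t ⟨ht.1, by linarith [ht.2]⟩) ?_
    exact h1.le_mono (by linarith) (by linarith) (by linarith)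
  have hLm : L ∈ Icc (-p + L) (p - L) := ⟨by linarith, by linarith⟩
  -- If the Wronskian of `u` and `u(· + p)` is zero, then `u` is trivial or `u(· + p) = l u` on the
  -- window, and `‖l‖ ≥ 1` or `‖l‖ ≤ 1` decides which neighbour dominates.
  by_cases hW : u L * w (L + p) - u (L + p) * w L = 0
  · right
    by_cases h0 : u L = 0 ∧ w L = 0
    · intro x hx
      rw [((h L x).eq_zero hg (left_mem_Icc.2 hx.1) (right_mem_Icc.2 hx.1) h0.1 h0.2).1, norm_zero]
      positivity
    obtain ⟨l, hl1, hl2⟩ : ∃ l : ℂ, u (L + p) - l * u L = 0 ∧ w (L + p) - l * w L = 0 := by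
      by_cases hu0 : u L = 0
      · have hw0 : w L ≠ 0 := fun hw0 => h0 ⟨hu0, hw0⟩
        refine ⟨w (L + p) / w L, ?_, ?_⟩
        · rw [hu0] at hW ⊢
          have : u (L + p) * w L = 0 := by linear_combination -hW
          rw [(mul_eq_zero.1 this).resolve_right hw0]
          ring
        · field_simp
          ring
      · refine ⟨u (L + p) / u L, ?_, ?_⟩
        · field_simp
          ring
        · field_simp
          linear_combination hW
    have hl : ∀ x ∈ Icc (-p + L) (p - L), u (x + p) = l * u x := fun x hx =>
      sub_eq_zero.1 ((h1.sub_const_mul hg (h _ _) l).eq_zero hg hLm hx hl1 hl2).1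
    intro x hx
    rcases le_total 1 ‖l‖ with hl' | hl'
    · have e := hl x ⟨by linarith [hx.1], by linarith [hx.2]⟩
      have : ‖u x‖ ≤ ‖u (x + p)‖ := by
        rw [e, norm_mul]
        exact le_mul_of_one_le_left (norm_nonneg _) hl'
      linarith [norm_nonneg (u (x - p))]
    · have e := hl (x - p) ⟨by linarith [hx.1], by linarith [hx.2]⟩
      rw [sub_add_cancel] at e
      have : ‖u x‖ ≤ ‖u (x - p)‖ := by
        rw [e, norm_mul]
        exact mul_le_of_le_one_left (norm_nonneg _) hl'
      linarith [norm_nonneg (u (x + p))]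
  · set c := u L * w (L + p) - u (L + p) * w L with hc
    set d := u (-L) * w (-L + p + p) - u (-L + p + p) * w (-L) with hd
    have hLm' : -L ∈ Icc (-p + L) (-L) := ⟨by linarith, le_rfl⟩
    -- For `uᵢ = u(· + ip)` the identity `u₂ W₀₁ - u₁ W₀₂ + u₀ W₁₂ = 0` holds, with `W₀₁ = c` and
    -- `W₀₂ = d`. Moreover `W₁₂(x) = W₀₁(x + p) = c`, which gives `u₀` the coefficient `-1`.
    have hrec : ∀ x ∈ Icc (-p + L) (-L), u (x + p + p) = d / c * u (x + p) - u x := by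
      intro x hx
      have e01 := (h _ _).wronskian_eq hg h1 hLm (t := x) ⟨hx.1, by linarith [hx.2]⟩
      have e12 := (h _ _).wronskian_eq hg h1 hLm (t := x + p)
        ⟨by linarith [hx.1], by linarith [hx.2]⟩
      have e02 := (h _ _).wronskian_eq hg h2 hLm' hx
      rw [← hc] at e01 e12
      rw [← hd] at e02
      field_simp
      linear_combination u (x + p + p) * e01 - u (x + p) * e02 + u x * e12
    -- A small coefficient allows solving for the outer term `u x`; a large one allows solving for
    -- the middle term, after a shift by `-p`.
    rcases le_total ‖d / c‖ 1 with hβ | hβ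
    · left
      intro x hx
      have e := hrec x ⟨by linarith [hx.1], hx.2⟩
      have e' : u x = d / c * u (x + p) - u (x + p + p) := by rw [e]; ring
      rw [e']
      refine (norm_sub_le _ _).trans ?_
      rw [norm_mul]
      gcongr
      exact mul_le_of_le_one_left (norm_nonneg _) hβ
    · right
      intro x hx
      have e := hrec (x - p) ⟨by linarith [hx.1], by linarith [hx.2]⟩
      rw [sub_add_cancel] at e
      have e' : d / c * u x = u (x - p) + u (x + p) := by rw [e]; ring
      calc ‖u x‖ ≤ ‖d / c‖ * ‖u x‖ := le_mul_of_one_le_left (norm_nonneg _) hβ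
        _ = ‖u (x - p) + u (x + p)‖ := by rw [← norm_mul, e']
        _ ≤ _ := norm_add_le _ _

end IsQuasiSolution

/-! ### Square integrability and vanishing of solutions. -/

theorem MeasureTheory.Integrable.tendsto_intervalIntegral_translate {f : ℝ → ℝ}
    (hf : Integrable f) (a b : ℝ) {q : ℕ → ℝ}
    (hq : Tendsto q atTop atTop ∨ Tendsto q atTop atBot) :
    Tendsto (fun n => ∫ x in a..b, f (x + q n)) atTop (𝓝 0) := by
  have e : ∀ n, ∫ x in a..b, f (x + q n)
      = (∫ x in (0 : ℝ)..(b + q n), f x) - ∫ x in (0 : ℝ)..(a + q n), f x := fun n => by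
    rw [intervalIntegral.integral_comp_add_right, intervalIntegral.integral_interval_sub_left]
      <;> exact hf.intervalIntegrable
  simp_rw [e]
  rcases hq with hq | hq
  · have := (intervalIntegral_tendsto_integral_Ioi 0 hf.integrableOn
      (tendsto_atTop_add_const_left _ b hq)).sub
      (intervalIntegral_tendsto_integral_Ioi 0 hf.integrableOn
      (tendsto_atTop_add_const_left _ a hq))
    rwa [sub_self] at this
  · simp_rw [intervalIntegral.integral_symm _ (0 : ℝ)]
    have := (intervalIntegral_tendsto_integral_Iic 0 hf.integrableOn
      (tendsto_atBot_add_const_left _ b hq)).neg.sub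
      (intervalIntegral_tendsto_integral_Iic 0 hf.integrableOn
      (tendsto_atBot_add_const_left _ a hq)).neg
    rwa [sub_self] at this

/-- Squaring with `(x + y)² ≤ 2x² + 2y²` and integrating bounds the fixed integral of `‖u‖²` by
integrals over intervals escaping to infinity. -/
theorem eqOn_zero_of_frequently_norm_le {u : ℝ → ℂ} (hu : Continuous u)
    (hi : Integrable fun x => ‖u x‖ ^ 2) {a b : ℝ} (hab : a < b) {q r : ℕ → ℝ}
    (hq : Tendsto q atTop atTop ∨ Tendsto q atTop atBot)
    (hr : Tendsto r atTop atTop ∨ Tendsto r atTop atBot)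
    (h : ∃ᶠ n in atTop, ∀ x ∈ Icc a b, ‖u x‖ ≤ ‖u (x + q n)‖ + ‖u (x + r n)‖) :
    ∀ x ∈ Icc a b, u x = 0 := by
  have hc : ∀ l : ℝ, Continuous fun x => ‖u (x + l)‖ ^ 2 := fun l =>
    (hu.comp (continuous_add_const l)).norm.pow 2
  have hlim := ((hi.tendsto_intervalIntegral_translate a b hq).const_mul 2).add
    ((hi.tendsto_intervalIntegral_translate a b hr).const_mul 2)
  simp only [mul_zero, add_zero] at hlim
  have hle : ∃ᶠ n in atTop, ∫ x in a..b, ‖u x‖ ^ 2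
      ≤ 2 * (∫ x in a..b, ‖u (x + q n)‖ ^ 2) + 2 * ∫ x in a..b, ‖u (x + r n)‖ ^ 2 := by
    refine h.mono fun n hn => ?_
    have hcq := ((hc (q n)).intervalIntegrable (μ := volume) a b).const_mul 2
    have hcr := ((hc (r n)).intervalIntegrable (μ := volume) a b).const_mul 2
    rw [← intervalIntegral.integral_const_mul, ← intervalIntegral.integral_const_mul,
      ← intervalIntegral.integral_add hcq hcr]
    refine intervalIntegral.integral_mono_on hab.le ((hu.norm.pow 2).intervalIntegrable _ _)
      (hcq.add hcr) fun x hx => ?_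
    have h1 := hn x hx
    nlinarith [norm_nonneg (u x), sq_nonneg (‖u (x + q n)‖ - ‖u (x + r n)‖)]
  have h0 : ∫ x in a..b, ‖u x‖ ^ 2 ≤ 0 := ge_of_tendsto_of_frequently hlim hle
  by_contra! hne
  obtain ⟨x, hx, hux⟩ := hne
  have hpos := intervalIntegral.integral_pos (f := fun x => ‖u x‖ ^ 2) hab
    (hu.norm.pow 2).continuousOn (fun y _ => sq_nonneg _) ⟨x, hx, pow_pos (norm_pos_iff.2 hux) 2⟩
  exact absurd h0 (not_le.2 hpos)

/-- Gordon's theorem for the system `u' = w`, `dw = g u dm`. -/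
theorem IsQuasiSolution.eq_zero_of_frequently_periodic {m : Measure ℝ} [IsLocallyFiniteMeasure m]
    {g u w : ℝ → ℂ} {L : ℝ} {p : ℕ → ℝ} (hg : LocallyIntegrable g m) (hL : 0 ≤ L)
    (hp : Tendsto p atTop atTop)
    (hper : ∃ᶠ n in atTop, ∀ f : ℝ → ℂ, Continuous f →
      ∀ s ∈ Icc (-p n + L) (p n - L), ∀ t ∈ Icc (-p n + L) (p n - L),
      ∫ x in s..t, g x * f (x + p n) ∂m = ∫ x in (s + p n)..(t + p n), g x * f x ∂m)
    (h : ∀ a b, IsQuasiSolution m g a b u w) (hi : Integrable fun x => ‖u x‖ ^ 2) (x : ℝ) :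
    u x = 0 := by
  have hu := (h 0 0).continuous
  have hlarge := hp.eventually_ge_atTop (2 * L + 1)
  have key := (hper.and_eventually hlarge).mono fun n hn =>
    IsQuasiSolution.norm_le_or_norm_le hg hL hn.2 hn.1 h
  -- One alternative occurs infinitely often, and its interval, `[-L - 1, -L]` or `[L, L + 1]`, is
  -- independent of `n`.
  rw [frequently_or_distrib] at key
  have hfin : ∀ c d, c < d → (∀ y ∈ Icc c d, u y = 0) → u x = 0 := fun c d hcd h0 =>
    (h (min c x) (max d x)).eq_zero_of_eqOn_zero hg (min_le_left _ _) hcd (le_max_left _ _) h0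
      ⟨min_le_right _ _, le_max_right _ _⟩
  rcases key with key | key
  · refine hfin _ _ (by linarith) (eqOn_zero_of_frequently_norm_le hu hi (by linarith : -L - 1 < -L)
      (q := p) (r := fun n => p n + p n) (Or.inl hp) (Or.inl (hp.atTop_add_atTop hp)) ?_)
    simpa only [add_assoc] using key
  · refine hfin _ _ (by linarith) (eqOn_zero_of_frequently_norm_le hu hi (by linarith : L < L + 1)
      (q := fun n => -p n) (r := p) (Or.inr (tendsto_neg_atTop_atBot.comp hp)) (Or.inl hp) ?_)
    simpa only [sub_eq_add_neg] using key

/-! ### Local measures as differences of locally finite measures. -/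

theorem MeasureTheory.SignedMeasure.apply_eq_posPart_sub_negPart (s : SignedMeasure ℝ) {B : Set ℝ}
    (hB : MeasurableSet B) : s B = (s.toJordanDecomposition.posPart B).toReal
      - (s.toJordanDecomposition.negPart B).toReal := by
  conv_lhs => rw [← s.toSignedMeasure_toJordanDecomposition]
  rw [JordanDecomposition.toSignedMeasure, sub_apply,
    Measure.toSignedMeasure_apply_measurable hB, Measure.toSignedMeasure_apply_measurable hB]
  rfl

namespace LocalMeasure

instance (μ : LocalMeasure) : IsLocallyFiniteMeasure μ.posPart :=
  isLocallyFiniteMeasure_of_isFiniteMeasureOnCompacts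

instance (μ : LocalMeasure) : IsLocallyFiniteMeasure μ.negPart :=
  isLocallyFiniteMeasure_of_isFiniteMeasureOnCompacts

theorem iUnion_inter_Ioc_int (B : Set ℝ) : ⋃ n : ℤ, B ∩ Ioc (n : ℝ) (n + 1) = B := by
  rw [← inter_iUnion, iUnion_Ioc_intCast, inter_univ]

theorem hasSum_toReal_sum_restrict (m : ℤ → Measure ℝ) {B : Set ℝ} (hB : MeasurableSet B)
    (hfin : (Measure.sum fun n : ℤ => (m n).restrict (Ioc (n : ℝ) (n + 1))) B ≠ ∞) :
    HasSum (fun n : ℤ => (m n (B ∩ Ioc (n : ℝ) (n + 1))).toReal)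
      ((Measure.sum fun n : ℤ => (m n).restrict (Ioc (n : ℝ) (n + 1))) B).toReal := by
  rw [Measure.sum_apply _ hB] at hfin ⊢
  simp_rw [Measure.restrict_apply hB] at hfin ⊢
  rw [ENNReal.tsum_toReal_eq (ENNReal.ne_top_of_tsum_ne_top hfin)]
  exact ENNReal.hasSum_toReal hfin

theorem toFun_eq (μ : LocalMeasure) (B : BoundedBorel) :
    μ.toFun B = (μ.posPart B.1).toReal - (μ.negPart B.1).toReal := by
  obtain ⟨R, hR⟩ := B.2.1.subset_closedBall 0
  have hK : IsCompact (Metric.closedBall (0 : ℝ) R) := isCompact_closedBall 0 R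
  obtain ⟨s, hs⟩ := μ.exists_restrict _ hK
  have hm : ∀ n : ℤ, MeasurableSet (B.1 ∩ Ioc (n : ℝ) (n + 1)) := fun n =>
    B.2.2.inter measurableSet_Ioc
  have h1 : HasSum (fun n : ℤ => s (B.1 ∩ Ioc (n : ℝ) (n + 1))) (s B.1) := by
    have := s.hasSum_of_disjoint_iUnion hm (fun i j hij =>
      (pairwise_disjoint_Ioc_intCast ℝ hij).mono inter_subset_right inter_subset_right)
    rwa [iUnion_inter_Ioc_int] at this
  have hBfin : ∀ m : Measure ℝ, IsFiniteMeasureOnCompacts m → m B.1 ≠ ∞ := fun m _ =>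
    ((measure_mono hR).trans_lt hK.measure_lt_top).ne
  have h2 := hasSum_toReal_sum_restrict
    (fun n : ℤ => (μ.restrictIcc n (n + 1)).toJordanDecomposition.posPart) B.2.2
    (hBfin μ.posPart inferInstance)
  have h3 := hasSum_toReal_sum_restrict
    (fun n : ℤ => (μ.restrictIcc n (n + 1)).toJordanDecomposition.negPart) B.2.2
    (hBfin μ.negPart inferInstance)
  have h4 : s B.1 = μ.toFun B := by
    rw [hs _ B.2.2]
    congr 1
    exact Subtype.ext (inter_eq_left.2 hR)
  rw [← h4]
  -- On `B ∩ (n, n + 1]`, the restrictions of `μ` to the large ball and to `[n, n + 1]` agree, so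
  -- the glued Jordan parts recover `s` piece by piece.
  have e : (fun n : ℤ => s (B.1 ∩ Ioc (n : ℝ) (n + 1))) = fun n : ℤ =>
      ((μ.restrictIcc n (n + 1)).toJordanDecomposition.posPart (B.1 ∩ Ioc (n : ℝ) (n + 1))).toReal
      - ((μ.restrictIcc n (n + 1)).toJordanDecomposition.negPart
        (B.1 ∩ Ioc (n : ℝ) (n + 1))).toReal := by
    funext n
    rw [← SignedMeasure.apply_eq_posPart_sub_negPart _ (hm n), restrictIcc_apply _ _ _ _ (hm n),
      hs _ (hm n)]
    congr 1
    refine Subtype.ext ?_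
    simp only [BoundedBorel.interCompact]
    rw [inter_eq_left.2 (inter_subset_left.trans hR),
      inter_eq_left.2 (inter_subset_right.trans Ioc_subset_Icc_self)]
  rw [e] at h1
  exact h1.unique (h2.sub h3)

end LocalMeasure

instance MeasureTheory.Measure.isLocallyFiniteMeasure_add (a b : Measure ℝ)
    [IsLocallyFiniteMeasure a] [IsLocallyFiniteMeasure b] : IsLocallyFiniteMeasure (a + b) := by
  have : IsFiniteMeasureOnCompacts (a + b) := ⟨fun K hK => by
    rw [Measure.add_apply]
    exact ENNReal.add_lt_top.2 ⟨hK.measure_lt_top, hK.measure_lt_top⟩⟩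
  exact isLocallyFiniteMeasure_of_isFiniteMeasureOnCompacts

section Differences

variable {a b c d : Measure ℝ} [IsLocallyFiniteMeasure a] [IsLocallyFiniteMeasure b]
  [IsLocallyFiniteMeasure c] [IsLocallyFiniteMeasure d] {J : Set ℝ}

/-- Two representations of a signed measure need not have equal parts. Writing `a - b = c - d` as `a
+ d = c + b` reduces the comparison to positive measures. -/
theorem restrict_add_eq_of_forall_toReal_sub_eq (hJ : MeasurableSet J) (hb : Bornology.IsBounded J)
    (h : ∀ B ⊆ J, MeasurableSet B →
      (a B).toReal - (b B).toReal = (c B).toReal - (d B).toReal) :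
    (a + d).restrict J = (c + b).restrict J := by
  ext B hB
  rw [Measure.restrict_apply hB, Measure.restrict_apply hB, Measure.add_apply, Measure.add_apply]
  have hfin : ∀ m : Measure ℝ, IsLocallyFiniteMeasure m → m (B ∩ J) ≠ ∞ := fun m _ =>
    (hb.subset inter_subset_right).measure_lt_top.ne
  have h1 := h (B ∩ J) inter_subset_right (hB.inter hJ)
  rw [← ENNReal.toReal_eq_toReal_iff'
    (ENNReal.add_ne_top.2 ⟨hfin a inferInstance, hfin d inferInstance⟩)
    (ENNReal.add_ne_top.2 ⟨hfin c inferInstance, hfin b inferInstance⟩),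
    ENNReal.toReal_add (hfin a inferInstance) (hfin d inferInstance),
    ENNReal.toReal_add (hfin c inferInstance) (hfin b inferInstance)]
  linarith

theorem setIntegral_sub_eq_of_restrict_add_eq {E : Type*} [NormedAddCommGroup E] [NormedSpace ℝ E]
    {f : ℝ → E} (hf : Continuous f) (hb : Bornology.IsBounded J)
    (h : (a + d).restrict J = (c + b).restrict J) :
    ∫ x in J, f x ∂a - ∫ x in J, f x ∂b = ∫ x in J, f x ∂c - ∫ x in J, f x ∂d := by
  have hi : ∀ m : Measure ℝ, IsLocallyFiniteMeasure m → Integrable f (m.restrict J) := by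
    intro m _
    obtain ⟨R, hR⟩ := hb.subset_closedBall 0
    exact (hf.locallyIntegrable.integrableOn_isCompact (isCompact_closedBall 0 R)).mono_set hR
  have h1 : ∫ x in J, f x ∂(a + d) = ∫ x in J, f x ∂(c + b) := by rw [h]
  rw [Measure.restrict_add, Measure.restrict_add,
    integral_add_measure (hi a inferInstance) (hi d inferInstance),
    integral_add_measure (hi c inferInstance) (hi b inferInstance)] at h1
  rw [sub_eq_sub_iff_add_eq_add, h1]

/-- With a cutoff `χ` supported in `U` and equal to `1` on `K`, the finite measures `χ a` and `χ b`
agree on bounded continuous functions, hence are equal. -/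
theorem restrict_eq_of_forall_integral_eq {U K : Set ℝ} (hU : IsOpen U)
    (hUb : Bornology.IsBounded U) (hK : IsCompact K) (hKU : K ⊆ U)
    (h : ∀ φ : C_c(ℝ, ℝ), tsupport φ ⊆ U → ∫ x, φ x ∂a = ∫ x, φ x ∂b) :
    a.restrict K = b.restrict K := by
  obtain ⟨χ, hχU, hχ1, hχ⟩ :=
    exists_tsupport_one_of_isOpen_isClosed hU hUb.isCompact_closure hK.isClosed hKU
  have hχs : HasCompactSupport χ :=
    HasCompactSupport.of_support_subset_isCompact hUb.isCompact_closure
      (subset_tsupport _ |>.trans (hχU.trans subset_closure))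
  have hmeas : Measurable fun x => ENNReal.ofReal (χ x) :=
    ENNReal.measurable_ofReal.comp χ.continuous.measurable
  have hfin : ∀ m : Measure ℝ, IsLocallyFiniteMeasure m →
      IsFiniteMeasure (m.withDensity fun x => ENNReal.ofReal (χ x)) := fun m _ =>
    isFiniteMeasure_withDensity_ofReal (χ.continuous.integrable_of_hasCompactSupport hχs).2
  have := hfin a inferInstance
  have := hfin b inferInstance
  have key : (a.withDensity fun x => ENNReal.ofReal (χ x))
      = b.withDensity fun x => ENNReal.ofReal (χ x) := by
    refine ext_of_forall_integral_eq_of_IsFiniteMeasure fun f => ?_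
    rw [integral_withDensity_eq_integral_toReal_smul hmeas
        (Eventually.of_forall fun _ => ENNReal.ofReal_lt_top),
      integral_withDensity_eq_integral_toReal_smul hmeas
        (Eventually.of_forall fun _ => ENNReal.ofReal_lt_top)]
    have e : ∀ x, (ENNReal.ofReal (χ x)).toReal • f x = χ x * f x := fun x => by
      rw [ENNReal.toReal_ofReal (hχ x).1, smul_eq_mul]
    simp_rw [e]
    exact h ⟨⟨fun x => χ x * f x, χ.continuous.mul f.continuous⟩, hχs.mul_right⟩
      ((tsupport_mul_subset_left (f := χ) (g := f)).trans hχU)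
  have hval : ∀ m : Measure ℝ, ∀ B, MeasurableSet B →
      m.restrict K B = (m.withDensity fun x => ENNReal.ofReal (χ x)) (B ∩ K) := by
    intro m B hB
    rw [Measure.restrict_apply hB, withDensity_apply _ (hB.inter hK.measurableSet),
      setLIntegral_congr_fun (g := fun _ => 1) (hB.inter hK.measurableSet)
        (fun x hx => by simp only [hχ1 hx.2, Pi.one_apply, ENNReal.ofReal_one]), setLIntegral_one]
  ext B hB
  rw [hval a B hB, hval b B hB, key]

end Differences

/-! ### Translations, and periodicity as a vaguely closed condition. -/

namespace LocalMeasure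

instance (m : Measure ℝ) [IsLocallyFiniteMeasure m] (t : ℝ) :
    IsLocallyFiniteMeasure (m.map fun x => x - t) := by
  have : IsFiniteMeasureOnCompacts (m.map (Homeomorph.subRight t)) :=
    Measure.IsFiniteMeasureOnCompacts.map m (Homeomorph.subRight t)
  exact isLocallyFiniteMeasure_of_isFiniteMeasureOnCompacts (μ := m.map (Homeomorph.subRight t))

theorem integral_map_sub {E : Type*} [NormedAddCommGroup E] [NormedSpace ℝ E] (m : Measure ℝ)
    (t : ℝ) (f : ℝ → E) : ∫ x, f x ∂(m.map fun x => x - t) = ∫ x, f (x - t) ∂m :=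
  (Homeomorph.subRight t).measurableEmbedding.integral_map f

theorem integral_sub_eq_of_forall_toReal_sub_eq {a b c d : Measure ℝ} [IsLocallyFiniteMeasure a]
    [IsLocallyFiniteMeasure b] [IsLocallyFiniteMeasure c] [IsLocallyFiniteMeasure d] {J : Set ℝ}
    (hJ : MeasurableSet J) (hb : Bornology.IsBounded J)
    (h : ∀ B ⊆ J, MeasurableSet B →
      (a B).toReal - (b B).toReal = (c B).toReal - (d B).toReal)
    {f : ℝ → ℝ} (hf : Continuous f) (hfJ : Function.support f ⊆ J) :
    ∫ x, f x ∂a - ∫ x, f x ∂b = ∫ x, f x ∂c - ∫ x, f x ∂d := by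
  have := setIntegral_sub_eq_of_restrict_add_eq hf hb
    (restrict_add_eq_of_forall_toReal_sub_eq hJ hb h)
  have e : ∀ m : Measure ℝ, ∫ x in J, f x ∂m = ∫ x, f x ∂m := fun m =>
    setIntegral_eq_integral_of_forall_compl_eq_zero fun x hx => by
      by_contra h0
      exact hx (hfJ h0)
  simpa only [e] using this

/-- The positive and negative parts are never compared across the translation: by `toFun_eq` the
differences agree on bounded Borel sets, and that suffices. -/
theorem integral_translate (μ : LocalMeasure) (t : ℝ) {φ : ℝ → ℝ} (hφ : Continuous φ)
    (hs : HasCompactSupport φ) :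
    (μ.translate t).integral φ = μ.integral fun x => φ (x - t) := by
  rw [integral, integral, ← integral_map_sub μ.posPart, ← integral_map_sub μ.negPart]
  refine integral_sub_eq_of_forall_toReal_sub_eq (J := tsupport φ)
    (isClosed_tsupport φ).measurableSet hs.isCompact.isBounded
    (fun B hB hBm => ?_) hφ (subset_tsupport φ)
  have hm : Measurable fun x : ℝ => x - t := measurable_id.sub_const t
  rw [Measure.map_apply hm hBm, Measure.map_apply hm hBm]
  exact ((μ.translate t).toFun_eq ⟨B, hs.isCompact.isBounded.subset hB, hBm⟩).symm.trans
    (μ.toFun_eq (BoundedBorel.translate t ⟨B, hs.isCompact.isBounded.subset hB, hBm⟩))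

theorem translate_translate (μ : LocalMeasure) (s t : ℝ) :
    (μ.translate s).translate t = μ.translate (s + t) := by
  ext B
  refine congrArg μ.toFun (Subtype.ext ?_)
  ext x
  simp only [BoundedBorel.translate, mem_preimage]
  rw [sub_sub]

theorem translate_zero (μ : LocalMeasure) : μ.translate 0 = μ := by
  ext B
  refine congrArg μ.toFun (Subtype.ext ?_)
  ext x
  simp only [BoundedBorel.translate, mem_preimage, sub_zero]

/-- The local measures that are `p`-periodic on `(-p + N, 2 p - N)`, tested on continuous
functions. -/
def periodicSet (p N : ℝ) : Set LocalMeasure :=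
  {μ | ∀ φ ψ : C_c(ℝ, ℝ), tsupport φ ⊆ Ioo (-p + N) (p - N) → (∀ x, ψ x = φ (x - p)) →
    μ.integral ψ = μ.integral φ}

theorem continuous_integral (φ : C_c(ℝ, ℝ)) : Continuous fun μ : LocalMeasure => μ.integral φ :=
  (continuous_apply φ).comp
    (continuous_induced_dom (f := fun (μ : LocalMeasure) (φ : C_c(ℝ, ℝ)) => μ.integral φ))

theorem isClosed_periodicSet (p N : ℝ) : IsClosed (periodicSet p N) := by
  simp only [periodicSet, ofPred_forall]
  exact isClosed_iInter fun φ => isClosed_iInter fun ψ => isClosed_iInter fun _ =>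
    isClosed_iInter fun _ => isClosed_eq (continuous_integral ψ) (continuous_integral φ)

/-- The translate `φ(· - t)`. -/
def shiftTest (φ : C_c(ℝ, ℝ)) (t : ℝ) : C_c(ℝ, ℝ) :=
  ⟨⟨fun x => φ (x - t), φ.continuous.comp (continuous_sub_right t)⟩,
    φ.hasCompactSupport.comp_homeomorph (Homeomorph.subRight t)⟩

theorem tsupport_shiftTest (φ : C_c(ℝ, ℝ)) (t : ℝ) :
    tsupport (shiftTest φ t) = (fun x => x - t) ⁻¹' tsupport φ :=
  tsupport_comp_eq_preimage φ (Homeomorph.subRight t)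

/-- Shifting by `t` costs at most `|t|` at either end of the window; this is the reason for the
margin parameter. -/
theorem translate_mem_periodicSet {μ : LocalMeasure} {p N M t : ℝ} (h : μ ∈ periodicSet p N)
    (ht : |t| ≤ M - N) : μ.translate t ∈ periodicSet p M := by
  intro φ ψ hφ hψ
  refine (integral_translate μ t ψ.continuous ψ.hasCompactSupport).trans (Eq.trans ?_
    (integral_translate μ t φ.continuous φ.hasCompactSupport).symm)
  refine h (shiftTest φ t) (shiftTest ψ t) ?_ fun x => ?_
  · rw [tsupport_shiftTest]
    intro x hx
    have h1 := hφ hx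
    have h2 := abs_le.1 ht
    exact ⟨by linarith [h1.1], by linarith [h1.2]⟩
  · change ψ (x - t) = φ (x - p - t)
    rw [hψ, sub_right_comm]

/-- Periodicity tested on smooth cutoffs must be upgraded to sharp intervals `(s, t]`, whose
endpoints may be atoms. This is possible because `[s, t]` is compact in the open window. -/
theorem integral_comp_add_eq_of_mem_periodicSet {μ : LocalMeasure} {p N : ℝ}
    (h : μ ∈ periodicSet p N) {f : ℝ → ℂ} (hf : Continuous f) {s t : ℝ}
    (hs : s ∈ Ioo (-p + N) (p - N)) (ht : t ∈ Ioo (-p + N) (p - N)) :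
    (∫ x in s..t, f (x + p) ∂μ.posPart) - ∫ x in s..t, f (x + p) ∂μ.negPart
      = (∫ x in (s + p)..(t + p), f x ∂μ.posPart) - ∫ x in (s + p)..(t + p), f x ∂μ.negPart := by
  have hK : uIcc s t ⊆ Ioo (-p + N) (p - N) := ordConnected_Ioo.uIcc_subset hs ht
  have hint : ∀ (φ : C_c(ℝ, ℝ)) (m : Measure ℝ), IsLocallyFiniteMeasure m → Integrable φ m :=
    fun φ m _ => φ.continuous.integrable_of_hasCompactSupport φ.hasCompactSupport
  have key := restrict_eq_of_forall_integral_eq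
    (a := μ.posPart + μ.negPart.map fun x => x - p)
    (b := (μ.posPart.map fun x => x - p) + μ.negPart) isOpen_Ioo
    (Metric.isBounded_Ioo _ _) isCompact_uIcc hK fun φ hφ => by
      rw [integral_add_measure (hint φ _ inferInstance) (hint φ _ inferInstance),
        integral_add_measure (hint φ _ inferInstance) (hint φ _ inferInstance),
        integral_map_sub, integral_map_sub]
      have := h φ (shiftTest φ p) hφ fun x => rfl
      rw [integral, integral] at this
      change ∫ x, φ (x - p) ∂μ.posPart - ∫ x, φ (x - p) ∂μ.negPart = _ at this
      linarith
  have hsub : ∀ s' t', Ioc s' t' ⊆ uIcc s t →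
      ∫ x in Ioc s' t', f (x + p) ∂μ.posPart - ∫ x in Ioc s' t', f (x + p) ∂μ.negPart
      = ∫ x in Ioc (s' + p) (t' + p), f x ∂μ.posPart
        - ∫ x in Ioc (s' + p) (t' + p), f x ∂μ.negPart := by
    intro s' t' hst
    have hr : (μ.posPart + μ.negPart.map fun x => x - p).restrict (Ioc s' t')
        = ((μ.posPart.map fun x => x - p) + μ.negPart).restrict (Ioc s' t') := by
      rw [← Measure.restrict_restrict_of_subset hst, key, Measure.restrict_restrict_of_subset hst]
    refine (setIntegral_sub_eq_of_restrict_add_eq (hf.comp (continuous_add_const p))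
      (Metric.isBounded_Ioc _ _) hr).trans ?_
    have e : ∀ m : Measure ℝ, ∫ x in Ioc s' t', f (x + p) ∂(m.map fun x => x - p)
        = ∫ x in Ioc (s' + p) (t' + p), f x ∂m := by
      intro m
      rw [← integral_indicator measurableSet_Ioc, integral_map_sub,
        ← integral_indicator measurableSet_Ioc]
      congr 1
      ext x
      simp only [indicator, mem_Ioc, sub_add_cancel, lt_sub_iff_add_lt, sub_le_iff_le_add]
    rw [← e, ← e]
    rfl
  simp only [intervalIntegral]
  have h1 := hsub s t (Ioc_subset_Icc_self.trans Icc_subset_uIcc)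
  have h2 := hsub t s (Ioc_subset_Icc_self.trans Icc_subset_uIcc')
  linear_combination h1 - h2

end LocalMeasure

namespace LocalMeasure

theorem toFun_union (μ : LocalMeasure) (A B C : BoundedBorel) (hC : C.1 = A.1 ∪ B.1)
    (hAB : Disjoint A.1 B.1) : μ.toFun C = μ.toFun A + μ.toFun B := by
  rw [μ.toFun_eq, μ.toFun_eq A, μ.toFun_eq B, hC, measure_union hAB B.2.2,
    measure_union hAB B.2.2, ENNReal.toReal_add A.2.1.measure_lt_top.ne B.2.1.measure_lt_top.ne,
    ENNReal.toReal_add A.2.1.measure_lt_top.ne B.2.1.measure_lt_top.ne]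
  ring

theorem mem_periodicSet_of_restrictIcc_eq {μ : LocalMeasure} {p : ℝ}
    (h1 : μ.restrictIcc 0 p = (μ.translate p).restrictIcc 0 p)
    (h2 : (μ.translate p).restrictIcc 0 p = (μ.translate (-p)).restrictIcc 0 p) :
    μ ∈ periodicSet p 0 := by
  have hval : ∀ (ν : LocalMeasure) (B : BoundedBorel), B.1 ⊆ Icc 0 p →
      ν.restrictIcc 0 p B.1 = ν.toFun B := fun ν B hB => by
    rw [restrictIcc_apply _ _ _ _ B.2.2]
    exact congrArg ν.toFun (Subtype.ext (inter_eq_left.2 hB))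
  have hpos : ∀ B : BoundedBorel, B.1 ⊆ Icc 0 p → μ.toFun (B.translate p) = μ.toFun B :=
    fun B hB => by
      have := hval (μ.translate p) B hB
      rw [← h1, hval μ B hB] at this
      exact this.symm
  have hneg : ∀ B : BoundedBorel, B.1 ⊆ Icc 0 p → μ.toFun (B.translate (-p)) = μ.toFun B :=
    fun B hB => by
      have := hval (μ.translate (-p)) B hB
      rw [← h2, ← h1, hval μ B hB] at this
      exact this.symm
  -- Splitting at `0`, the nonnegative piece uses the `α_p` equality. The negative piece is moved by
  -- `p` into `[0, p]`, where the `α_{-p}` equality carries it back.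
  have hall : ∀ B : BoundedBorel, B.1 ⊆ Icc (-p) p → μ.toFun (B.translate p) = μ.toFun B := by
    intro B hB
    let B₁ : BoundedBorel := ⟨B.1 ∩ Ici 0, B.2.1.subset inter_subset_left,
      B.2.2.inter measurableSet_Ici⟩
    let B₂ : BoundedBorel := ⟨B.1 ∩ Iio 0, B.2.1.subset inter_subset_left,
      B.2.2.inter measurableSet_Iio⟩
    have hdis : Disjoint B₁.1 B₂.1 := by
      rw [disjoint_left]
      exact fun x hx hx' => not_lt.2 (mem_Ici.1 hx.2) (mem_Iio.1 hx'.2)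
    have hun : B.1 = B₁.1 ∪ B₂.1 := by
      change B.1 = B.1 ∩ Ici 0 ∪ B.1 ∩ Iio 0
      rw [← inter_union_distrib_left, Ici_union_Iio, inter_univ]
    have e₁ : μ.toFun (B₁.translate p) = μ.toFun B₁ :=
      hpos B₁ fun x hx => ⟨hx.2, (hB hx.1).2⟩
    have e₂ : μ.toFun (B₂.translate p) = μ.toFun B₂ := by
      rw [← hneg (B₂.translate p) ?_]
      · refine congrArg μ.toFun (Subtype.ext ?_)
        ext x
        simp only [BoundedBorel.translate, mem_preimage, sub_neg_eq_add, add_sub_cancel_right]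
      · intro x hx
        have hx1 : x - p ∈ B.1 := hx.1
        have hx2 : x - p < 0 := hx.2
        exact ⟨by linarith [(hB hx1).1], by linarith⟩
    rw [μ.toFun_union B₁ B₂ B hun hdis,
      μ.toFun_union (B₁.translate p) (B₂.translate p) (B.translate p) ?_ ?_, e₁, e₂]
    · change (fun x => x - p) ⁻¹' B.1 = _
      rw [hun]
      rfl
    · exact hdis.preimage _
  intro φ ψ hφ hψ
  have e : μ.integral ψ = μ.integral fun x => φ (x - p) := congrArg _ (funext hψ)
  rw [e]
  refine (integral_translate μ p φ.continuous φ.hasCompactSupport).symm.trans ?_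
  refine integral_sub_eq_of_forall_toReal_sub_eq measurableSet_Icc (Metric.isBounded_Icc (-p) p)
    (fun B hB hBm => ?_) φ.continuous ((subset_tsupport φ).trans (hφ.trans ?_))
  · have hBb := (Metric.isBounded_Icc (-p) p).subset hB
    exact ((μ.translate p).toFun_eq ⟨B, hBb, hBm⟩).symm.trans
      ((hall ⟨B, hBb, hBm⟩ hB).trans (μ.toFun_eq ⟨B, hBb, hBm⟩))
  · rw [add_zero, sub_zero]
    exact Ioo_subset_Icc_self

/-! ### The density of `μ - z dx` and absence of eigenvalues for a fixed `μ`. -/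

/-- A measure dominating `μ` and the Lebesgue measure. -/
noncomputable def dominating (μ : LocalMeasure) : Measure ℝ := μ.posPart + μ.negPart + volume

instance (μ : LocalMeasure) : IsLocallyFiniteMeasure μ.dominating := by
  unfold dominating
  infer_instance

/-- The density of `μ - z dx` with respect to `μ.dominating`. -/
noncomputable def coeff (μ : LocalMeasure) (z : ℂ) (x : ℝ) : ℂ :=
  ((μ.posPart.rnDeriv μ.dominating x).toReal : ℂ) - (μ.negPart.rnDeriv μ.dominating x).toReal
    - z * (volume.rnDeriv μ.dominating x).toReal

theorem posPart_absolutelyContinuous (μ : LocalMeasure) : μ.posPart ≪ μ.dominating :=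
  Measure.absolutelyContinuous_of_le
    ((Measure.le_add_right le_rfl).trans (Measure.le_add_right le_rfl))

theorem negPart_absolutelyContinuous (μ : LocalMeasure) : μ.negPart ≪ μ.dominating :=
  Measure.absolutelyContinuous_of_le
    ((Measure.le_add_left le_rfl).trans (Measure.le_add_right le_rfl))

theorem volume_absolutelyContinuous (μ : LocalMeasure) : volume ≪ μ.dominating :=
  Measure.absolutelyContinuous_of_le (Measure.le_add_left le_rfl)

theorem locallyIntegrable_coeff (μ : LocalMeasure) (z : ℂ) :
    LocallyIntegrable (μ.coeff z) μ.dominating := by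
  have h : ∀ m : Measure ℝ, IsLocallyFiniteMeasure m →
      LocallyIntegrable (fun x => ((m.rnDeriv μ.dominating x).toReal : ℂ)) μ.dominating := by
    intro m _
    rw [locallyIntegrable_iff]
    exact fun K hK => (Measure.integrableOn_toReal_rnDeriv hK.measure_lt_top.ne).ofReal
  exact ((h _ inferInstance).sub (h _ inferInstance)).sub ((h _ inferInstance).smul z)

theorem setIntegral_coeff_mul (μ : LocalMeasure) (z : ℂ) {f : ℝ → ℂ} {s : Set ℝ}
    (hs : MeasurableSet s) (hf : ∀ m : Measure ℝ, IsLocallyFiniteMeasure m → IntegrableOn f s m) :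
    ∫ x in s, μ.coeff z x * f x ∂μ.dominating
      = ∫ x in s, f x ∂μ.posPart - ∫ x in s, f x ∂μ.negPart - z * ∫ x in s, f x := by
  have hint : ∀ m : Measure ℝ, IsLocallyFiniteMeasure m → m ≪ μ.dominating →
      Integrable (fun x => ((m.rnDeriv μ.dominating x).toReal : ℂ) * f x)
        (μ.dominating.restrict s) ∧
      ∫ x in s, ((m.rnDeriv μ.dominating x).toReal : ℂ) * f x ∂μ.dominating
        = ∫ x in s, f x ∂m := by
    intro m hm hac
    simp_rw [← Complex.real_smul]
    refine ⟨?_, setIntegral_rnDeriv_smul hac hs⟩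
    have h1 := (integrable_rnDeriv_smul_iff hac).2 ((hf m hm).integrable_indicator hs)
    have h2 := (integrable_indicator_iff hs (μ := μ.dominating)
      (f := fun x => (m.rnDeriv μ.dominating x).toReal • f x)).1
    refine h2 (h1.congr (Eventually.of_forall fun x => ?_))
    by_cases hx : x ∈ s
    · simp only [indicator_of_mem hx]
    · simp only [indicator_of_notMem hx, smul_zero]
  obtain ⟨i1, e1⟩ := hint _ inferInstance μ.posPart_absolutelyContinuous
  obtain ⟨i2, e2⟩ := hint _ inferInstance μ.negPart_absolutelyContinuous
  obtain ⟨i3, e3⟩ := hint _ inferInstance μ.volume_absolutelyContinuous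
  simp only [coeff, sub_mul, mul_assoc]
  have i12 := i1.sub i2
  have i3' := i3.const_mul z
  simp only [Pi.sub_def] at i12
  rw [integral_sub i12 i3', integral_sub i1 i2, integral_const_mul, e1, e2, e3]

theorem intervalIntegral_coeff_mul (μ : LocalMeasure) (z : ℂ) {f : ℝ → ℂ} (hf : Continuous f)
    (s t : ℝ) : ∫ x in s..t, μ.coeff z x * f x ∂μ.dominating
      = (∫ x in s..t, f x ∂μ.posPart) - (∫ x in s..t, f x ∂μ.negPart) - z * ∫ x in s..t, f x := by
  simp only [intervalIntegral]
  rw [μ.setIntegral_coeff_mul z measurableSet_Ioc fun m _ => hf.integrableOn_Ioc,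
    μ.setIntegral_coeff_mul z measurableSet_Ioc fun m _ => hf.integrableOn_Ioc]
  ring

theorem exists_isQuasiSolution_of_weakEquation (μ : LocalMeasure) (z : ℂ) {u f : ℝ → ℂ}
    (hu : Continuous u) (hf : f =ᵐ[volume] fun x => z * u x) (h : μ.WeakEquation u f) :
    ∃ w : ℝ → ℂ, ∀ a b, IsQuasiSolution μ.dominating (μ.coeff z) a b u w := by
  refine exists_isQuasiSolution (μ.locallyIntegrable_coeff z) hu fun φ hφ hs => ?_
  have h1 := h φ hφ hs
  have h2 : ∫ x, f x * φ x = z * ∫ x, u x * φ x := by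
    rw [← integral_const_mul]
    refine integral_congr_ae ?_
    filter_upwards [hf] with x hx
    rw [hx, mul_assoc]
  have h3 := μ.setIntegral_coeff_mul z (f := fun x => u x * φ x) MeasurableSet.univ
    fun m _ => (hu.integrable_mul_of_hasCompactSupport hφ.continuous hs).integrableOn
  simp only [Measure.restrict_univ, ← mul_assoc] at h3
  rw [h2, integral] at h1
  rw [h3]
  linear_combination -h1

theorem pointSpectrum_schrodinger_eq_empty (μ : LocalMeasure) {p : ℕ → ℝ} {N : ℝ} (hN : 0 ≤ N)
    (hp : Tendsto p atTop atTop) (h : ∃ᶠ n in atTop, μ ∈ periodicSet (p n) N) :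
    μ.schrodinger.pointSpectrum = ∅ := by
  rw [eq_empty_iff_forall_notMem]
  rintro z ⟨u, hu0, huz⟩
  have hgr : ((u : Lp ℂ 2 (volume : Measure ℝ)), μ.schrodinger u) ∈ μ.schrodingerGraph := by
    rw [← schrodinger_graph]
    exact LinearPMap.mem_graph _ u
  obtain ⟨v, hv, huv, hw⟩ := hgr
  simp only at huv hw
  have hf : (μ.schrodinger u : ℝ → ℂ) =ᵐ[volume] fun x => z * v x := by
    rw [huz]
    filter_upwards [Lp.coeFn_smul z (u : Lp ℂ 2 (volume : Measure ℝ)), huv] with x hx hx'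
    rw [hx, Pi.smul_apply, smul_eq_mul, hx']
  obtain ⟨w, hq⟩ := μ.exists_isQuasiSolution_of_weakEquation z hv hf hw
  have hi : Integrable fun x => ‖v x‖ ^ 2 :=
    (memLp_two_iff_integrable_sq_norm hv.aestronglyMeasurable).1
      ((memLp_congr_ae huv).1 (Lp.memLp _))
  have hzero : ∀ x, v x = 0 := by
    -- The extra `1` places the closed window inside the open one used by `periodicSet`.
    refine IsQuasiSolution.eq_zero_of_frequently_periodic (L := N + 1)
      (μ.locallyIntegrable_coeff z) (by linarith) hp ?_ hq hi
    refine h.mono fun n hn f hfc s hs t ht => ?_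
    rw [μ.intervalIntegral_coeff_mul z (f := fun x => f (x + p n))
        (hfc.comp (continuous_add_const (p n))), μ.intervalIntegral_coeff_mul z hfc,
      integral_comp_add_eq_of_mem_periodicSet hn hfc ⟨by linarith [hs.1], by linarith [hs.2]⟩
        ⟨by linarith [ht.1], by linarith [ht.2]⟩, intervalIntegral.integral_comp_add_right]
  refine hu0 (Subtype.ext ?_)
  rw [Submodule.coe_zero, Lp.eq_zero_iff_ae_eq_zero]
  filter_upwards [huv] with x hx
  rw [hx, hzero x, Pi.zero_apply]

end LocalMeasure

/-! ### Measurability, invariance and the zero-one law. -/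

theorem limsup_measure_le_measure_frequently {α : Type*} [MeasurableSpace α] (P : Measure α)
    [IsFiniteMeasure P] {s : ℕ → Set α} (hs : ∀ n, MeasurableSet (s n)) :
    limsup (fun n => P (s n)) atTop ≤ P {x | ∃ᶠ n in atTop, x ∈ s n} := by
  have e : {x | ∃ᶠ n in atTop, x ∈ s n} = ⋂ k, ⋃ n ≥ k, s n := by
    ext x
    simp [frequently_atTop]
  have hanti : Antitone fun k => ⋃ n ≥ k, s n := fun i j hij =>
    iUnion_mono fun n => iUnion_mono' fun h => ⟨hij.trans h, subset_rfl⟩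
  have hm : ∀ k, NullMeasurableSet (⋃ n ≥ k, s n) P := fun k =>
    (MeasurableSet.iUnion fun n => MeasurableSet.iUnion fun _ => hs n).nullMeasurableSet
  rw [e, hanti.measure_iInter hm ⟨0, measure_ne_top _ _⟩, limsup_eq_iInf_iSup_of_nat]
  exact iInf_mono fun k => iSup₂_le fun n hn => measure_mono (subset_iUnion₂_of_subset n hn subset_rfl)

theorem measurableSet_frequently_mem {α : Type*} [MeasurableSpace α] {s : ℕ → Set α}
    (hs : ∀ n, MeasurableSet (s n)) : MeasurableSet {x | ∃ᶠ n in atTop, x ∈ s n} := by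
  have e : {x | ∃ᶠ n in atTop, x ∈ s n} = ⋂ k, ⋃ n ≥ k, s n := by
    ext x
    simp [frequently_atTop]
  rw [e]
  exact MeasurableSet.iInter fun k => MeasurableSet.iUnion fun n => MeasurableSet.iUnion fun _ => hs n

namespace IsPotentialSpace

/-- The `ω ∈ Ω` that have, for infinitely many `n`, period `p n` on an interval of length
`3 p n - O(1)` around the origin. -/
def asymptoticallyPeriodicSet (Ω : Set LocalMeasure) (p : ℕ → ℝ) : Set Ω :=
  {ω | ∃ N : ℕ, ∃ᶠ n in atTop, ω.1 ∈ LocalMeasure.periodicSet (p n) N}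

theorem measurableSet_coe_preimage_periodicSet (Ω : Set LocalMeasure) (p N : ℝ) :
    MeasurableSet ((↑) ⁻¹' LocalMeasure.periodicSet p N : Set Ω) :=
  measurable_subtype_coe (LocalMeasure.isClosed_periodicSet p N).measurableSet

theorem measurableSet_asymptoticallyPeriodicSet (Ω : Set LocalMeasure) (p : ℕ → ℝ) :
    MeasurableSet (asymptoticallyPeriodicSet Ω p) := by
  have e : asymptoticallyPeriodicSet Ω p = ⋃ N : ℕ, {ω : Ω | ∃ᶠ n in atTop,
      ω ∈ ((↑) ⁻¹' LocalMeasure.periodicSet (p n) N : Set Ω)} := by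
    ext ω
    simp [asymptoticallyPeriodicSet]
  rw [e]
  exact MeasurableSet.iUnion fun N => measurableSet_frequently_mem fun n =>
    measurableSet_coe_preimage_periodicSet Ω (p n) N

theorem shift_mem_asymptoticallyPeriodicSet {Ω : Set LocalMeasure} (hΩ : IsPotentialSpace Ω)
    {p : ℕ → ℝ} {ω : Ω} (t : ℝ) (h : ω ∈ asymptoticallyPeriodicSet Ω p) :
    hΩ.shift t ω ∈ asymptoticallyPeriodicSet Ω p := by
  obtain ⟨N, hN⟩ := h
  refine ⟨N + ⌈|t|⌉₊, hN.mono fun n hn => LocalMeasure.translate_mem_periodicSet hn ?_⟩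
  push_cast
  linarith [Nat.le_ceil |t|]

theorem shift_neg_shift {Ω : Set LocalMeasure} (hΩ : IsPotentialSpace Ω) (t : ℝ) (ω : Ω) :
    hΩ.shift (-t) (hΩ.shift t ω) = ω := by
  have h : (ω.1.translate t).translate (-t) = ω.1 := by
    rw [LocalMeasure.translate_translate, add_neg_cancel, LocalMeasure.translate_zero]
  exact Subtype.ext h

theorem preimage_shift_asymptoticallyPeriodicSet {Ω : Set LocalMeasure} (hΩ : IsPotentialSpace Ω)
    (p : ℕ → ℝ) (t : ℝ) :
    hΩ.shift t ⁻¹' asymptoticallyPeriodicSet Ω p = asymptoticallyPeriodicSet Ω p := by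
  refine Subset.antisymm (fun ω h => ?_)
    fun ω h => mem_preimage.2 (hΩ.shift_mem_asymptoticallyPeriodicSet t h)
  have h' := hΩ.shift_mem_asymptoticallyPeriodicSet (-t) (mem_preimage.1 h)
  rwa [hΩ.shift_neg_shift t ω] at h'

theorem gordonSet_subset_periodicSet {Ω : Set LocalMeasure} (hΩ : IsPotentialSpace Ω) (p : ℝ) :
    hΩ.gordonSet p ⊆ (↑) ⁻¹' LocalMeasure.periodicSet p 0 := fun _ h =>
  LocalMeasure.mem_periodicSet_of_restrictIcc_eq h.1 h.2

theorem IsErgodic.ae_mem_asymptoticallyPeriodicSet {Ω : Set LocalMeasure} {hΩ : IsPotentialSpace Ω}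
    {P : Measure Ω} (hP : hΩ.IsErgodic P) {p : ℕ → ℝ}
    (h : 0 < limsup (fun n => P (hΩ.gordonSet (p n))) atTop) :
    ∀ᵐ ω ∂P, ω ∈ asymptoticallyPeriodicSet Ω p := by
  have := hP.isProbabilityMeasure
  have hm := measurableSet_asymptoticallyPeriodicSet Ω p
  have hpos : 0 < P (asymptoticallyPeriodicSet Ω p) := by
    -- Measurability of `gordonSet` is not needed: it is enlarged to the Borel set given by
    -- `periodicSet` with `N = 0` before the reverse Fatou inequality is applied.
    refine h.trans_le (((limsup_le_limsup (Eventually.of_forall fun n =>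
      measure_mono (hΩ.gordonSet_subset_periodicSet (p n)))).trans
      (limsup_measure_le_measure_frequently P fun n =>
        measurableSet_coe_preimage_periodicSet Ω (p n) 0)).trans (measure_mono fun ω hω => ?_))
    refine ⟨0, ?_⟩
    rw [Nat.cast_zero]
    exact hω
  rcases hP.zero_one _ hm (hΩ.preimage_shift_asymptoticallyPeriodicSet p) with h0 | h1
  · exact absurd h0 hpos.ne'
  · exact (prob_compl_eq_zero_iff hm).2 h1

end IsPotentialSpace

theorem mainTheorem2 (Ω : Set LocalMeasure) (hΩ : IsPotentialSpace Ω) (P : MeasureTheory.Measure Ω)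
    (hP : hΩ.IsErgodic P) (hK : hΩ.ConditionK P) :
    ∀ᵐ ω : Ω ∂P, ω.1.schrodinger.pointSpectrum = ∅ := by
  obtain ⟨p, _, hp, hpos⟩ := hK
  filter_upwards [hP.ae_mem_asymptoticallyPeriodicSet hpos] with ω hω
  obtain ⟨N, hN⟩ := hω
  exact ω.1.pointSpectrum_schrodinger_eq_empty N.cast_nonneg hp hN
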